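/- Let $\mathbb{Z}^2_{even}=\{(x,t)\in\mathbb{Z}^2 : x+t \text{ is even}\}$. The dynamical discrete web is defined as follows. Each site $z\in\mathbb{Z}^2_{even}$ carries an arrow $\xi_z^\tau\in\{-1,+1\}$ that evolves in a dynamical time $\tau\ge 0$: the initial arrow $\xi_z^0$ is uniform on $\{-1,+1\}$, and at each ring of a rate-one Poisson clock attached to $z$ the arrow is reset to a fresh uniform value in $\{-1,+1\}$ (with $\tau\mapsto\xi_z^\tau$ right-continuous). All initial arrows, clocks and reset values, at all sites, are independent. For each $\tau$, let $S_0^\tau$ be the path that starts from $S_0^\tau(0)=0$ and follows the arrows at dynamical time $\tau$, i.e. $S_0^\tau(n+1)=S_0^\tau(n)+\xi^\tau_{(S_0^\tau(n),\,n)}$ for integers $n\ge 0$, interpolated linearly between consecutive integer times. For $K\in(0,\infty)$, a path $\pi:[0,\infty)\to\mathbb{R}$ with $\pi(0)=0$ is called $K^+$-subdiffusive if there exists $j\ge 0$ such that $\pi(t)\ge -j-K\sqrt{t}$ for all $t>0$. Then there exists $K_0\in(0,\infty)$ such that for every $K\ge K_0$, $$\mathbb{P}\big(\exists\,\tau\in[0,1]\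 \text{such that}\ S_0^\tau\ \text{is}\ K^+\text{-subdiffusive}\big)>0,$$ in the sense that this event contains a measurable event of strictly positive probability. -/

import Mathlib

open MeasureTheory ProbabilityTheory

/-- The space-time lattice `ℤ²_even = {(x, t) ∈ ℤ² : x + t even}`. -/
abbrev EvenSite : Type := {z : ℤ × ℤ // Even (z.1 + z.2)}

/-- The space-time origin `(0, 0)`. -/
def EvenSite.origin : EvenSite := ⟨(0, 0), by simp⟩

/-- An arrow is a Boolean: `true` points to the right (increment `+1`),
`false` points to the left (increment `-1`). -/
def increment (b : Bool) : ℤ := if b then 1 else -1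

/-- The endpoint `(x + ξ_{x,t}, t + 1)` of the arrow at `z = (x, t)`. -/
def followArrow (ξ : EvenSite → Bool) (z : EvenSite) : EvenSite :=
  ⟨(z.1.1 + increment (ξ z), z.1.2 + 1), by
    have h := z.2
    cases hb : ξ z <;> simp only [increment] <;> grind⟩

/-- The position, `n` time steps after the start, of the path of the discrete web with arrow
configuration `ξ` that starts from `z`. -/
def webPath (ξ : EvenSite → Bool) (z : EvenSite) (n : ℕ) : ℤ :=
  ((followArrow ξ)^[n] z).1.1

/-- The continuous path in real time `t ≥ 0` which is linear between consecutive integer times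
and takes the values `s n` at integer times. -/
noncomputable def linearInterpolation (s : ℕ → ℤ) (t : ℝ) : ℝ :=
  (s ⌊t⌋₊ : ℝ) + (t - ⌊t⌋₊) * ((s (⌊t⌋₊ + 1) : ℝ) - (s ⌊t⌋₊ : ℝ))

/-- `K⁺`-subdiffusivity of a path (defined for times `t ≥ 0`):
there is `j ≥ 0` with `π t ≥ -j - K √t` for all `t > 0`. -/
def IsPlusSubdiffusive (K : ℝ) (π : ℝ → ℝ) : Prop :=
  ∃ j : ℝ, 0 ≤ j ∧ ∀ t : ℝ, 0 < t → π t ≥ -j - K * √t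

/-- The dynamical discrete web on a probability space `(Ω, P)`. Every site carries a rate one
Poisson clock, given by its i.i.d. exponential waiting times, and i.i.d. fair arrows:
the initial one (index `0`) and the ones to which the site is reset at its successive rings.
All these variables, over all sites, are independent. -/
structure DynamicalDiscreteWeb {Ω : Type*} [MeasurableSpace Ω] (P : Measure Ω) where
  /-- `wait z n` is the waiting time between ring `n` and ring `n + 1` of the clock at `z`
  (from dynamical time `0` to the first ring, if `n = 0`). -/
  wait : EvenSite → ℕ → Ω → ℝ
  /-- `arrow z n` is the direction of the arrow at `z` after `n` rings. -/
  arrow : EvenSite → ℕ → Ω → Bool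
  measurable_wait : ∀ z n, Measurable (wait z n)
  measurable_arrow : ∀ z n, Measurable (arrow z n)
  wait_law : ∀ z n, P.map (wait z n) = expMeasure 1
  arrow_law : ∀ z n b, P {ω | arrow z n ω = b} = 1 / 2
  indep_wait : iIndepFun (fun (i : EvenSite × ℕ) ω => wait i.1 i.2 ω) P
  indep_arrow : iIndepFun (fun (i : EvenSite × ℕ) ω => arrow i.1 i.2 ω) P
  indep_wait_arrow : IndepFun (fun ω (i : EvenSite × ℕ) => wait i.1 i.2 ω)
    (fun ω (i : EvenSite × ℕ) => arrow i.1 i.2 ω) P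

namespace DynamicalDiscreteWeb

variable {Ω : Type*} [MeasurableSpace Ω] {P : Measure Ω} (W : DynamicalDiscreteWeb P)

/-- The dynamical time of the `(n + 1)`-st ring of the clock at `z`. -/
def ringTime (z : EvenSite) (n : ℕ) (ω : Ω) : ℝ :=
  ∑ i ∈ Finset.range (n + 1), W.wait z i ω

/-- The number of rings of the clock at `z` up to and including dynamical time `τ`
(almost surely finite). -/
noncomputable def ringCount (z : EvenSite) (τ : ℝ) (ω : Ω) : ℕ :=
  {n : ℕ | W.ringTime z n ω ≤ τ}.ncard

/-- The arrow configuration at dynamical time `τ`, right continuous in `τ`. -/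
noncomputable def arrowAt (τ : ℝ) (ω : Ω) (z : EvenSite) : Bool :=
  W.arrow z (W.ringCount z τ ω) ω

/-- The path `S_0^τ` from the space-time origin in the web at dynamical time `τ`. -/
noncomputable def originPath (τ : ℝ) (ω : Ω) : ℝ → ℝ :=
  linearInterpolation (webPath (W.arrowAt τ ω) EvenSite.origin)

end DynamicalDiscreteWeb

/-! Real time is cut into scales: scale `k` lasts `4 ^ (k + 1)` steps, and the barrier drops by `4 *
2 ^ (k + 1)` during it. `ScaleEvent ξ k` says that the path from the barrier's corner at the start
of scale `k` stays above the lowered barrier. Paths of one web do not cross, so if all scale events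
hold, the path from the origin stays above a curve of order `-√t`
(`isPlusSubdiffusive_of_scaleEvent`). Scale events use disjoint levels of arrows, so they are
independent. At a fixed `τ` almost surely not all of them hold; exceptional times come from the
second moment of `scaleTime n`, the Lebesgue measure of the `τ` at which the first `n` events hold.

Arrows of one site at times `Δ` apart have correlation `ρ = exp (-Δ)`. Two walks following these
webs are independent except when they meet, and half their difference is a lazy walk sticky at `0`.
The covariance of the two survival events is a sum over meetings of the squared gradient of
`stayProb`, which the reflection principle bounds by the inverse of the remaining time
(`pairStayProb_le`). Few meetings occur by a discrete Tanaka formula (`sum_returnProb_le`). At scale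
`k` the covariance is thus at most `64 * (3 / 4) ^ k / Δ`. The scales where this is not small are
bounded by full correlation, at total cost `2 / √Δ`; the others cost a constant
(`prod_le_of_decorrelation`). Since `Δ ^ (-1/2)` is integrable, the probability that `scaleTime n ≠
0` is bounded below uniformly in `n`.

It remains to pass to the limit (`exists_forall_scaleEvent`). Times `τ n` good for `n` scales
accumulate at some `τ₀`. If no clock rings at `τ₀`, each scale event is locally constant there.
Otherwise just one site rings, and the scale events above its level would all hold at a time
independent of them, which has probability zero. -/

/-! ### The sticky lazy walk on `ℤ` -/

/-- The transition operator of the lazy walk on `ℤ` (steps `-1, 0, 1` with probabilities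
`1/4, 1/2, 1/4`) that is sticky at `0`, which it leaves with probability `δ`. -/
noncomputable def stickyStep (δ : ℝ) (f : ℤ → ℝ) (d : ℤ) : ℝ :=
  if d = 0 then (1 - δ) * f 0 + δ / 2 * (f 1 + f (-1))
  else f (d - 1) / 4 + f d / 2 + f (d + 1) / 4

/-- The probability that the sticky walk started from `d` is at `0` after `n` steps. -/
noncomputable def returnProb (δ : ℝ) : ℕ → ℤ → ℝ
  | 0 => fun d => if d = 0 then 1 else 0
  | n + 1 => stickyStep δ (returnProb δ n)

lemma stickyStep_mono {δ : ℝ} (h0 : 0 ≤ δ) (h1 : δ ≤ 1 / 2) {f g : ℤ → ℝ} (h : ∀ d, f d ≤ g d)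
    (d : ℤ) : stickyStep δ f d ≤ stickyStep δ g d := by
  unfold stickyStep
  split_ifs
  · have := mul_le_mul_of_nonneg_left (h 0) (by linarith : 0 ≤ 1 - δ)
    have := mul_le_mul_of_nonneg_left (add_le_add (h 1) (h (-1))) (by linarith : 0 ≤ δ / 2)
    linarith
  · linarith [h (d - 1), h d, h (d + 1)]

lemma stickyStep_add (δ : ℝ) (f g : ℤ → ℝ) (d : ℤ) :
    stickyStep δ (fun e => f e + g e) d = stickyStep δ f d + stickyStep δ g d := by
  unfold stickyStep; split_ifs <;> ring

lemma stickyStep_const_mul (δ a : ℝ) (f : ℤ → ℝ) (d : ℤ) :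
    stickyStep δ (fun e => a * f e) d = a * stickyStep δ f d := by
  unfold stickyStep; split_ifs <;> ring

lemma stickyStep_const (δ a : ℝ) (d : ℤ) : stickyStep δ (fun _ => a) d = a := by
  unfold stickyStep; split_ifs <;> ring

lemma stickyStep_sum (δ : ℝ) (s : Finset ℕ) (a : ℕ → ℝ) (f : ℕ → ℤ → ℝ) (d : ℤ) :
    stickyStep δ (fun e => ∑ i ∈ s, a i * f i e) d = ∑ i ∈ s, a i * stickyStep δ (f i) d := by
  induction s using Finset.cons_induction with
  | empty => simpa using stickyStep_const δ 0 d
  | cons i s hi ih =>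
    simp only [Finset.sum_cons]
    rw [stickyStep_add, ih, stickyStep_const_mul]

lemma returnProb_nonneg {δ : ℝ} (h0 : 0 ≤ δ) (h1 : δ ≤ 1 / 2) (n : ℕ) (d : ℤ) :
    0 ≤ returnProb δ n d := by
  induction n generalizing d with
  | zero => simp only [returnProb]; split_ifs <;> norm_num
  | succ n ih =>
    have := stickyStep_mono h0 h1 (f := fun _ => 0) ih d
    rwa [stickyStep_const] at this

lemma returnProb_neg (δ : ℝ) (n : ℕ) (d : ℤ) : returnProb δ n (-d) = returnProb δ n d := by
  induction n generalizing d with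
  | zero => simp [returnProb]
  | succ n ih =>
    simp only [returnProb, stickyStep, neg_eq_zero]
    split_ifs
    · rfl
    · rw [show -d - 1 = -(d + 1) by ring, show -d + 1 = -(d - 1) by ring, ih, ih, ih]; ring

/-- Unimodality survives a step; the comparison of `0` with `1` is where `δ ≤ 1 / 2` enters. -/
lemma returnProb_succ_le {δ : ℝ} (h1 : δ ≤ 1 / 2) (n m : ℕ) :
    returnProb δ n (m + 1) ≤ returnProb δ n m := by
  induction n generalizing m with
  | zero => simp only [returnProb]; split_ifs <;> first | omega | norm_num
  | succ n ih =>
    have hm : ((m : ℤ) + 1) ≠ 0 := by omega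
    simp only [returnProb, stickyStep, if_neg hm]
    rcases Nat.eq_zero_or_pos m with rfl | hpos
    · have a := ih 0
      have b := ih 1
      have e := returnProb_neg δ n 1
      simp only [Nat.cast_zero, Nat.cast_one, if_true, zero_add] at *
      norm_num at *
      rw [e]
      nlinarith
    · have hm' : (m : ℤ) ≠ 0 := by omega
      obtain ⟨k, rfl⟩ : ∃ k, m = k + 1 := ⟨m - 1, by omega⟩
      have a := ih k
      have b := ih (k + 1)
      have c := ih (k + 2)
      rw [if_neg hm']
      push_cast at *
      rw [show (k : ℤ) + 1 + 1 - 1 = k + 1 by ring, show (k : ℤ) + 1 - 1 = k by ring,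
        show (k : ℤ) + 1 + 1 = k + 2 by ring]
      rw [show (k : ℤ) + 1 + 1 = k + 2 by ring] at b
      linarith

lemma returnProb_le_zero {δ : ℝ} (h1 : δ ≤ 1 / 2) (n : ℕ) (d : ℤ) :
    returnProb δ n d ≤ returnProb δ n 0 := by
  have key : ∀ m : ℕ, returnProb δ n m ≤ returnProb δ n 0 := by
    intro m
    induction m with
    | zero => simp
    | succ m ih => push_cast; exact (returnProb_succ_le h1 n m).trans ih
  rcases Int.eq_nat_or_neg d with ⟨m, rfl | rfl⟩
  · exact key m
  · rw [returnProb_neg]; exact key m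

lemma returnProb_zero_antitone {δ : ℝ} (h0 : 0 ≤ δ) (h1 : δ ≤ 1 / 2) :
    Antitone fun n => returnProb δ n 0 := by
  refine antitone_nat_of_succ_le fun n => ?_
  simp only [returnProb, stickyStep, if_true]
  nlinarith [returnProb_le_zero h1 n 1, returnProb_le_zero h1 n (-1)]

/-- `E |D_n|` for the sticky walk from `d`. -/
lemma iterate_stickyStep_abs (δ : ℝ) (n : ℕ) (d : ℤ) :
    (stickyStep δ)^[n] (fun e => |(e : ℝ)|) d =
      |(d : ℝ)| + δ * ∑ i ∈ Finset.range n, returnProb δ i d := by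
  induction n generalizing d with
  | zero => simp
  | succ n ih =>
    rw [Function.iterate_succ_apply', show (stickyStep δ)^[n] (fun e => |(e : ℝ)|) =
      fun e : ℤ => |(e : ℝ)| + δ * ∑ i ∈ Finset.range n, returnProb δ i e from funext ih,
      stickyStep_add, stickyStep_const_mul]
    have h := stickyStep_sum δ (Finset.range n) (fun _ => 1) (returnProb δ) d
    simp only [one_mul] at h
    rw [h, Finset.sum_range_succ']
    -- Discrete Tanaka formula: `|·|` is harmonic off `0` and gains `δ` at `0`.
    have habs : stickyStep δ (fun e => |(e : ℝ)|) d = |(d : ℝ)| + δ * returnProb δ 0 d := by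
      simp only [stickyStep, returnProb]
      split_ifs with hd
      · subst hd; simp; ring
      · rcases lt_or_gt_of_ne hd with h | h
        · have h' : (d : ℝ) ≤ -1 := by exact_mod_cast Int.le_sub_one_of_lt h
          push_cast
          rw [abs_of_nonpos (by linarith), abs_of_nonpos (by linarith),
            abs_of_nonpos (by linarith)]; ring
        · have h' : (1 : ℝ) ≤ d := by exact_mod_cast h
          push_cast
          rw [abs_of_nonneg (by linarith), abs_of_nonneg (by linarith),
            abs_of_nonneg (by linarith)]; ring
    rw [habs]
    simp only [returnProb]
    ring

/-- Jensen's inequality for an averaging operator: a variance is nonnegative. -/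
lemma sq_stickyStep_le {δ : ℝ} (h0 : 0 ≤ δ) (h1 : δ ≤ 1 / 2) (f : ℤ → ℝ) (d : ℤ) :
    stickyStep δ f d ^ 2 ≤ stickyStep δ (fun e => f e ^ 2) d := by
  set a := stickyStep δ f d with ha
  have h : 0 ≤ stickyStep δ (fun e => (f e - a) ^ 2) d := by
    have := stickyStep_mono h0 h1 (f := fun _ => 0) (g := fun e => (f e - a) ^ 2)
      (fun e => sq_nonneg _) d
    rwa [stickyStep_const] at this
  have e : stickyStep δ (fun e => (f e - a) ^ 2) d =
      stickyStep δ (fun e => f e ^ 2) d - 2 * a * stickyStep δ f d + a ^ 2 := by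
    unfold stickyStep; split_ifs <;> ring
  rw [e, ← ha] at h
  nlinarith

lemma sq_iterate_stickyStep_abs_le {δ : ℝ} (h0 : 0 ≤ δ) (h1 : δ ≤ 1 / 2) (n : ℕ) (d : ℤ) :
    ((stickyStep δ)^[n] (fun e => |(e : ℝ)|) d) ^ 2 ≤ (d : ℝ) ^ 2 + n / 2 := by
  induction n generalizing d with
  | zero => simp
  | succ n ih =>
    rw [Function.iterate_succ_apply']
    refine (sq_stickyStep_le h0 h1 _ d).trans ((stickyStep_mono h0 h1 ih d).trans ?_)
    rw [stickyStep_add, stickyStep_const]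
    have : stickyStep δ (fun e => (e : ℝ) ^ 2) d ≤ (d : ℝ) ^ 2 + 1 / 2 := by
      unfold stickyStep
      split_ifs with hd
      · subst hd; push_cast; nlinarith
      · push_cast; nlinarith
    push_cast
    linarith

/-- From `0`, `δ` times the sum is `E |D_n|`, and `E D_n ^ 2` grows by at most `1 / 2` per step. -/
lemma sum_returnProb_le {δ : ℝ} (h0 : 0 < δ) (h1 : δ ≤ 1 / 2) (n : ℕ) :
    ∑ i ∈ Finset.range n, returnProb δ i 0 ≤ √n / δ := by
  rw [le_div_iff₀ h0]
  refine Real.le_sqrt_of_sq_le ?_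
  have h := sq_iterate_stickyStep_abs_le h0.le h1 n 0
  rw [iterate_stickyStep_abs] at h
  simp at h
  have : (0 : ℝ) ≤ n := by positivity
  nlinarith

/-- Return probabilities decrease in time, so the last one is at most the average of the first `n +
1`. -/
lemma returnProb_half_sq_le (n : ℕ) : returnProb (1 / 2) n 0 ^ 2 ≤ 4 / (n + 1) := by
  have h := sum_returnProb_le (δ := 1 / 2) (by norm_num) le_rfl (n + 1)
  have h2 : ((n + 1 : ℕ) : ℝ) * returnProb (1 / 2) n 0 ≤
      ∑ i ∈ Finset.range (n + 1), returnProb (1 / 2) i 0 := by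
    have := Finset.card_nsmul_le_sum (Finset.range (n + 1)) (fun i => returnProb (1 / 2) i 0)
      (returnProb (1 / 2) n 0) (fun i hi => returnProb_zero_antitone (by norm_num) le_rfl
        (by simp at hi; omega))
    simpa using this
  have h0 := returnProb_nonneg (δ := 1 / 2) (by norm_num) le_rfl n 0
  have hs : √((n + 1 : ℕ) : ℝ) ^ 2 = (n + 1 : ℕ) := Real.sq_sqrt (by positivity)
  rw [le_div_iff₀ (by positivity)]
  have h3 : ((n + 1 : ℕ) : ℝ) * returnProb (1 / 2) n 0 ≤ 2 * √((n + 1 : ℕ) : ℝ) := by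
    linarith
  have h4 := mul_self_le_mul_self (by positivity) h3
  push_cast at *
  have h5 : ((n : ℝ) + 1) * (returnProb (1 / 2) n 0 ^ 2 * (n + 1)) ≤ (n + 1) * 4 := by
    nlinarith
  exact le_of_mul_le_mul_left h5 (by positivity)

/-! ### One walk staying nonnegative -/

/-- The probability that the simple random walk from `x` is nonnegative at times `0, …, s`. -/
noncomputable def stayProb : ℕ → ℤ → ℝ
  | 0, x => if 0 ≤ x then 1 else 0
  | s + 1, x => if 0 ≤ x then (stayProb s (x + 1) + stayProb s (x - 1)) / 2 else 0

lemma stayProb_of_neg (s : ℕ) {x : ℤ} (hx : x < 0) : stayProb s x = 0 := by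
  cases s <;> simp [stayProb, hx.not_ge]

lemma stayProb_succ (s : ℕ) {x : ℤ} (hx : 0 ≤ x) :
    stayProb (s + 1) x = (stayProb s (x + 1) + stayProb s (x - 1)) / 2 := by
  simp [stayProb, hx]

lemma stayProb_nonneg (s : ℕ) (x : ℤ) : 0 ≤ stayProb s x := by
  induction s generalizing x with
  | zero => simp only [stayProb]; split_ifs <;> norm_num
  | succ s ih => simp only [stayProb]; split_ifs; · linarith [ih (x + 1), ih (x - 1)]
                 · rfl

lemma stayProb_le_one (s : ℕ) (x : ℤ) : stayProb s x ≤ 1 := by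
  induction s generalizing x with
  | zero => simp only [stayProb]; split_ifs <;> norm_num
  | succ s ih => simp only [stayProb]; split_ifs; · linarith [ih (x + 1), ih (x - 1)]
                 · norm_num

lemma stayProb_succ_le (s : ℕ) (x : ℤ) : stayProb (s + 1) x ≤ stayProb s x := by
  induction s generalizing x with
  | zero =>
    rcases lt_or_ge x 0 with hx | hx
    · simp [stayProb_of_neg _ hx]
    · exact (stayProb_le_one _ _).trans (by simp [stayProb, hx])
  | succ s ih =>
    rcases lt_or_ge x 0 with hx | hx
    · simp [stayProb_of_neg _ hx]
    · rw [stayProb_succ _ hx, stayProb_succ _ hx]; linarith [ih (x + 1), ih (x - 1)]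

lemma stayProb_antitone (x : ℤ) : Antitone fun s => stayProb s x :=
  antitone_nat_of_succ_le fun s => stayProb_succ_le s x

lemma stayProb_le_succ_right (s : ℕ) (x : ℤ) : stayProb s x ≤ stayProb s (x + 1) := by
  induction s generalizing x with
  | zero => simp only [stayProb]; split_ifs <;> first | omega | norm_num
  | succ s ih =>
    rcases lt_or_ge x 0 with hx | hx
    · rw [stayProb_of_neg _ hx]; exact stayProb_nonneg _ _
    · rw [stayProb_succ _ hx, stayProb_succ _ (by omega)]
      have := ih (x - 1)
      have := ih (x + 1)
      rw [show x + 1 - 1 = x - 1 + 1 by ring]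
      linarith

lemma stayProb_mono (s : ℕ) : Monotone (stayProb s) :=
  monotone_int_of_le_succ fun x => stayProb_le_succ_right s x

/-- Kolmogorov's inequality for the walk from `x`, centred at an arbitrary `L`. -/
lemma one_sub_stayProb_le (L : ℕ) (s : ℕ) (x : ℤ) (hx : -1 ≤ x) :
    1 - stayProb s x ≤ (((x : ℝ) - L) ^ 2 + s) / (L + 1) ^ 2 := by
  have hL : (0 : ℝ) < ((L : ℝ) + 1) ^ 2 := by positivity
  -- Optional stopping: `(x - L) ^ 2 + s` is preserved by averaging over a step and is at least `(L
  -- + 1) ^ 2` at the killing site `-1`.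
  induction s generalizing x with
  | zero =>
    rcases eq_or_lt_of_le hx with rfl | hx
    · rw [stayProb_of_neg _ (by omega), le_div_iff₀ hL]; push_cast; nlinarith
    · have : 0 ≤ x := by omega
      simp only [stayProb, this, if_true]; norm_num; positivity
  | succ s ih =>
    rcases eq_or_lt_of_le hx with rfl | hx
    · rw [stayProb_of_neg _ (by omega), le_div_iff₀ hL]
      have : (0 : ℝ) ≤ ((s + 1 : ℕ) : ℝ) := by positivity
      push_cast at *; nlinarith
    · have h0 : 0 ≤ x := by omega
      have a := ih (x + 1) (by omega)
      have b := ih (x - 1) (by omega)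
      rw [stayProb_succ _ h0]
      rw [le_div_iff₀ hL] at *
      push_cast at *
      nlinarith

/-! ### Gradient of the survival probability, by reflection -/

/-- The odd extension about `-1` of the probability of staying nonnegative, a solution of the
free discrete heat equation. -/
noncomputable def oddStay : ℕ → ℤ → ℝ
  | 0, x => if 0 ≤ x then 1 else if x = -1 then 0 else -1
  | s + 1, x => (oddStay s (x + 1) + oddStay s (x - 1)) / 2

lemma oddStay_reflect (s : ℕ) (x : ℤ) : oddStay s (-2 - x) = -oddStay s x := by
  induction s generalizing x with
  | zero => simp only [oddStay]; split_ifs <;> first | omega | norm_num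
  | succ s ih =>
    simp only [oddStay]
    rw [show -2 - x + 1 = -2 - (x - 1) by ring, show -2 - x - 1 = -2 - (x + 1) by ring, ih, ih]
    ring

/-- Reflection principle: antisymmetry about `-1` forces the free solution to vanish there, like the
killed one. -/
lemma stayProb_eq_oddStay (s : ℕ) (x : ℤ) (hx : -1 ≤ x) : stayProb s x = oddStay s x := by
  induction s generalizing x with
  | zero => simp only [stayProb, oddStay]; split_ifs <;> first | omega | rfl
  | succ s ih =>
    rcases eq_or_lt_of_le hx with rfl | hx
    · rw [stayProb_of_neg _ (by omega)]
      have := oddStay_reflect (s + 1) (-1)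
      norm_num at this
      linarith
    · rw [stayProb_succ _ (by omega), oddStay, ih _ (by omega), ih _ (by omega)]

lemma oddStay_add_two (s : ℕ) (x : ℤ) :
    oddStay (s + 2) x = oddStay s (x - 2) / 4 + oddStay s x / 2 + oddStay s (x + 2) / 4 := by
  simp only [oddStay]
  rw [show x + 1 + 1 = x + 2 by ring, show x + 1 - 1 = x by ring, show x - 1 + 1 = x by ring,
    show x - 1 - 1 = x - 2 by ring]
  ring

lemma returnProb_half_succ (n : ℕ) (d : ℤ) : returnProb (1 / 2) (n + 1) d =
    returnProb (1 / 2) n (d - 1) / 4 + returnProb (1 / 2) n d / 2 +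
      returnProb (1 / 2) n (d + 1) / 4 := by
  simp only [returnProb, stickyStep]
  split_ifs with h
  · subst h; norm_num; ring
  · rfl

/-- Double steps on even sites form the lazy walk. The increments solve its heat equation, starting
from the jump from `-1` to `1` of the initial profile. -/
lemma oddStay_sub_odd (n : ℕ) (d : ℤ) :
    oddStay (2 * n) (2 * d) - oddStay (2 * n) (2 * d - 2) = 2 * returnProb (1 / 2) n d := by
  induction n generalizing d with
  | zero => simp only [oddStay, returnProb]; split_ifs <;> first | omega | norm_num
  | succ n ih =>
    rw [returnProb_half_succ, show 2 * (n + 1) = 2 * n + 2 by ring, oddStay_add_two,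
      oddStay_add_two]
    have a := ih (d - 1)
    have b := ih d
    have c := ih (d + 1)
    rw [show 2 * (d - 1) = 2 * d - 2 by ring] at a
    rw [show 2 * (d + 1) = 2 * d + 2 by ring] at c
    rw [show 2 * d - 2 + 2 = 2 * d by ring]
    rw [show 2 * d + 2 - 2 = 2 * d by ring] at c
    linarith

/-- On odd sites the value `0` at `-1` splits the initial jump evenly between `d = 0` and `d = -1`.
-/
lemma oddStay_sub_even (n : ℕ) (d : ℤ) :
    oddStay (2 * n) (2 * d + 1) - oddStay (2 * n) (2 * d - 1) =
      returnProb (1 / 2) n d + returnProb (1 / 2) n (d + 1) := by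
  induction n generalizing d with
  | zero => simp only [oddStay, returnProb]; split_ifs <;> first | omega | norm_num
  | succ n ih =>
    rw [returnProb_half_succ, returnProb_half_succ, show 2 * (n + 1) = 2 * n + 2 by ring,
      oddStay_add_two, oddStay_add_two]
    have a := ih (d - 1)
    have b := ih d
    have c := ih (d + 1)
    rw [show 2 * (d - 1) + 1 = 2 * d - 1 by ring, show 2 * (d - 1) - 1 = 2 * d - 1 - 2 by ring] at a
    rw [show 2 * (d + 1) + 1 = 2 * d + 1 + 2 by ring, show 2 * (d + 1) - 1 = 2 * d + 1 by ring] at c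
    rw [show 2 * d + 1 - 2 = 2 * d - 1 by ring, show 2 * d - 1 + 2 = 2 * d + 1 by ring]
    rw [show d - 1 + 1 = d by ring] at *
    rw [show d + 1 - 1 = d by ring]
    linarith

lemma oddStay_sub_le (s : ℕ) (x : ℤ) :
    oddStay s (x + 1) - oddStay s (x - 1) ≤ 2 * returnProb (1 / 2) (s / 2) 0 := by
  have key : ∀ n x, oddStay (2 * n) (x + 1) - oddStay (2 * n) (x - 1) ≤
      2 * returnProb (1 / 2) n 0 := by
    intro n x
    rcases Int.even_or_odd' x with ⟨d, rfl | rfl⟩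
    · rw [oddStay_sub_even]
      linarith [returnProb_le_zero (δ := 1 / 2) le_rfl n d,
        returnProb_le_zero (δ := 1 / 2) le_rfl n (d + 1)]
    · have := oddStay_sub_odd n (d + 1)
      rw [show 2 * d + 1 + 1 = 2 * (d + 1) by ring, show 2 * d + 1 - 1 = 2 * (d + 1) - 2 by ring]
      linarith [returnProb_le_zero (δ := 1 / 2) le_rfl n (d + 1)]
  rcases Nat.even_or_odd' s with ⟨n, rfl | rfl⟩
  · simpa using key n x
  · rw [show (2 * n + 1) / 2 = n by omega]
    simp only [oddStay]
    have a := key n (x + 1)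
    have b := key n (x - 1)
    rw [show x + 1 - 1 = x - 1 + 1 by ring] at *
    linarith

/-- This square is the covariance created by a common step of two walks that have `s` further steps
to go. -/
lemma stayProb_gradient_sq_le (s : ℕ) {x : ℤ} (hx : 0 ≤ x) :
    ((stayProb s (x + 1) - stayProb s (x - 1)) / 2) ^ 2 ≤ 8 / (s + 1) := by
  have h0 : 0 ≤ stayProb s (x + 1) - stayProb s (x - 1) :=
    sub_nonneg.2 (stayProb_mono s (by omega))
  have h : stayProb s (x + 1) - stayProb s (x - 1) ≤ 2 * returnProb (1 / 2) (s / 2) 0 := by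
    rw [stayProb_eq_oddStay _ _ (by omega), stayProb_eq_oddStay _ _ (by omega)]
    exact oddStay_sub_le s x
  calc ((stayProb s (x + 1) - stayProb s (x - 1)) / 2) ^ 2
      ≤ returnProb (1 / 2) (s / 2) 0 ^ 2 := pow_le_pow_left₀ (by linarith) (by linarith) 2
    _ ≤ 4 / ((s / 2 : ℕ) + 1) := returnProb_half_sq_le _
    _ ≤ 8 / (s + 1) := by
      rw [div_le_div_iff₀ (by positivity) (by positivity)]
      have : s ≤ 2 * (s / 2) + 1 := by omega
      have : (s : ℝ) ≤ 2 * ((s / 2 : ℕ) : ℝ) + 1 := by exact_mod_cast this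
      linarith

lemma stayProb_le_mul (s m : ℕ) : stayProb s m ≤ (m + 1) * (6 / √(s + 1)) := by
  have hstep : ∀ x : ℤ, 0 ≤ x → stayProb s x ≤ stayProb s (x - 1) + 6 / √(s + 1) := by
    intro x hx
    have h := stayProb_gradient_sq_le s hx
    have hp : (0 : ℝ) < √(s + 1) := Real.sqrt_pos.2 (by positivity)
    have hsq : √((s : ℝ) + 1) ^ 2 = s + 1 := Real.sq_sqrt (by positivity)
    -- The constant `3` bounds `√8`.
    have h1 : (stayProb s (x + 1) - stayProb s (x - 1)) / 2 ≤ 3 / √(s + 1) := by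
      refine le_of_sq_le_sq ?_ (by positivity)
      rw [div_pow 3, hsq]
      refine h.trans ?_
      gcongr; norm_num
    have := stayProb_le_succ_right s x
    have e : 6 / √((s : ℝ) + 1) = 2 * (3 / √(s + 1)) := by ring
    linarith
  induction m with
  | zero =>
    have := hstep 0 le_rfl
    rw [stayProb_of_neg s (show (0 : ℤ) - 1 < 0 by norm_num)] at this
    simpa using this
  | succ m ih =>
    have := hstep (m + 1) (by positivity)
    rw [show (m : ℤ) + 1 - 1 = m by ring] at this
    push_cast
    linarith

/-! ### Descents of diffusive depth -/

/-- To descend `x + y + 2` levels it is enough to descend `x + 1` and then `y + 1` levels. -/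
lemma one_sub_stayProb_mul_le (s t : ℕ) (x y : ℤ) (hx : -1 ≤ x) :
    (1 - stayProb s x) * (1 - stayProb t y) ≤ 1 - stayProb (s + t) (x + y + 1) := by
  have h1 := stayProb_le_one t y
  induction s generalizing x with
  | zero =>
    rcases eq_or_lt_of_le hx with rfl | hx
    · rw [stayProb_of_neg 0 (by norm_num)]; simp
    · have h0 : 0 ≤ x := by omega
      simp [stayProb, h0, stayProb_le_one]
  | succ s ih =>
    rcases eq_or_lt_of_le hx with rfl | hx
    · rw [stayProb_of_neg _ (by norm_num), show -1 + y + 1 = y by ring]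
      have := stayProb_antitone y (show t ≤ s + 1 + t by omega)
      simp only at this
      linarith
    · have h0 : 0 ≤ x := by omega
      have a := ih (x + 1) (by omega)
      have b := ih (x - 1) (by omega)
      rw [stayProb_succ _ h0]
      rcases lt_or_ge (x + y + 1) 0 with hn | hn
      · rw [stayProb_of_neg _ hn]
        have := stayProb_nonneg s (x + 1)
        have := stayProb_nonneg s (x - 1)
        have := stayProb_nonneg t y
        have := stayProb_le_one s (x + 1)
        have := stayProb_le_one s (x - 1)
        nlinarith
      · rw [show s + 1 + t = s + t + 1 by ring, stayProb_succ _ hn]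
        rw [show x + 1 + y + 1 = x + y + 1 + 1 by ring] at a
        rw [show x - 1 + y + 1 = x + y + 1 - 1 by ring] at b
        linarith

lemma one_sub_stayProb_pow_le (s m : ℕ) (M : ℕ) :
    (1 - stayProb s m) ^ M ≤ 1 - stayProb (M * s) (M * (m + 1) - 1) := by
  induction M with
  | zero => simpa using (stayProb_of_neg 0 (show (-1 : ℤ) < 0 by norm_num)).le
  | succ M ih =>
    have h := one_sub_stayProb_mul_le (M * s) s (M * (m + 1) - 1) m
      (by have : (0 : ℤ) ≤ M * (m + 1) := by positivity
          omega)
    rw [pow_succ]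
    have h1 := stayProb_le_one s m
    refine (mul_le_mul_of_nonneg_right ih (by linarith)).trans (h.trans_eq ?_)
    congr 2
    · ring
    · push_cast; ring

/-- On the diffusive scale, the walk does not stay nonnegative with probability close to `1`. -/
lemma exists_stayProb_le (c : ℕ) :
    ∃ q : ℝ, 0 ≤ q ∧ q < 1 ∧ ∃ k₁ : ℕ, ∀ k, k₁ ≤ k → stayProb (4 ^ k) (c * 2 ^ k : ℕ) ≤ q := by
  -- With `k = m + j + 4`, chain `4 ^ m` descents of `2 ^ j` levels, each succeeding within `4 ^ (j
  -- + 4)` steps with probability at least `1 / 2`. The total time is `4 ^ k`, and the choice of `m`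
  -- makes the total depth exceed `c * 2 ^ k`.
  obtain ⟨m, hm⟩ : ∃ m : ℕ, 16 * (c + 1) ≤ 2 ^ m := ⟨16 * (c + 1), Nat.lt_two_pow_self.le⟩
  refine ⟨1 - (1 / 2) ^ (4 ^ m), ?_, ?_, m + 5, fun k hk => ?_⟩
  · have : ((1 : ℝ) / 2) ^ (4 ^ m) ≤ 1 := pow_le_one₀ (by norm_num) (by norm_num)
    linarith
  · have : (0 : ℝ) < (1 / 2) ^ (4 ^ m) := by positivity
    linarith
  obtain ⟨j, rfl⟩ : ∃ j, k = m + (j + 4) := ⟨k - m - 4, by omega⟩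
  have hhalf : stayProb (4 ^ (j + 4)) (2 ^ j - 1 : ℕ) ≤ 1 / 2 := by
    refine (stayProb_le_mul _ _).trans ?_
    have hs : (2 : ℝ) ^ (j + 4) ≤ √((4 ^ (j + 4) : ℕ) + 1) := by
      refine Real.le_sqrt_of_sq_le ?_
      push_cast
      rw [← pow_mul, mul_comm, pow_mul]; norm_num
    have hc : (((2 ^ j - 1 : ℕ) : ℝ) + 1) = 2 ^ j := by
      rw [Nat.cast_sub Nat.one_le_two_pow]; push_cast; ring
    rw [hc]
    calc (2 : ℝ) ^ j * (6 / √((4 ^ (j + 4) : ℕ) + 1)) ≤ 2 ^ j * (6 / 2 ^ (j + 4)) := by gcongr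
      _ ≤ 1 / 2 := by rw [pow_add]; field_simp; norm_num
  have h := one_sub_stayProb_pow_le (4 ^ (j + 4)) (2 ^ j - 1) (4 ^ m)
  have h2 : ((1 : ℝ) / 2) ^ (4 ^ m) ≤ (1 - stayProb (4 ^ (j + 4)) (2 ^ j - 1 : ℕ)) ^ (4 ^ m) :=
    pow_le_pow_left₀ (by norm_num) (by linarith) _
  have h3 : stayProb (4 ^ (m + (j + 4))) (c * 2 ^ (m + (j + 4)) : ℕ) ≤
      stayProb (4 ^ m * 4 ^ (j + 4)) (((4 ^ m : ℕ) : ℤ) * (((2 ^ j - 1 : ℕ) : ℤ) + 1) - 1) := by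
    rw [pow_add 4]
    refine stayProb_mono _ ?_
    rw [Nat.cast_sub Nat.one_le_two_pow]
    push_cast
    have e : (4 : ℤ) ^ m = 2 ^ m * 2 ^ m := by rw [← mul_pow]; norm_num
    have hm' : (16 : ℤ) * (c + 1) ≤ 2 ^ m := by exact_mod_cast hm
    rw [e, pow_add, pow_add]
    have hp : (1 : ℤ) ≤ 2 ^ m * 2 ^ j := Order.one_le_iff_pos.2 (by positivity)
    have hq := mul_nonneg (sub_nonneg.2 hm') (zero_le_one.trans hp)
    nlinarith
  linarith

/-! ### Two walks in correlated webs -/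

/-- The probability that the walks from `x` and `y` are both nonnegative at times `0, …, s`, when
their steps are independent while they are apart and have correlation `ρ` while they are
together. -/
noncomputable def pairStayProb (ρ : ℝ) : ℕ → ℤ → ℤ → ℝ
  | 0, x, y => if 0 ≤ x ∧ 0 ≤ y then 1 else 0
  | s + 1, x, y =>
    if 0 ≤ x ∧ 0 ≤ y then
      if x = y then
        (1 + ρ) / 4 * (pairStayProb ρ s (x + 1) (y + 1) + pairStayProb ρ s (x - 1) (y - 1)) +
        (1 - ρ) / 4 * (pairStayProb ρ s (x + 1) (y - 1) + pairStayProb ρ s (x - 1) (y + 1))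
      else
        (pairStayProb ρ s (x + 1) (y + 1) + pairStayProb ρ s (x - 1) (y - 1) +
          pairStayProb ρ s (x + 1) (y - 1) + pairStayProb ρ s (x - 1) (y + 1)) / 4
    else 0

/-- Fully correlated walks from one point never separate, so one-time probabilities are the case `ρ
= 1` of two-time ones. -/
lemma pairStayProb_one (s : ℕ) (x : ℤ) : pairStayProb 1 s x x = stayProb s x := by
  induction s generalizing x with
  | zero => simp [pairStayProb, stayProb]
  | succ s ih =>
    simp only [pairStayProb, stayProb, and_self, if_true, ih]
    split_ifs
    · ring
    · rfl

/-- The covariance of the two events is controlled by the times at which the walks meet and by the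
gradient of `stayProb` at these times. -/
lemma pairStayProb_le {ρ : ℝ} (h0 : 0 ≤ ρ) (h1 : ρ ≤ 1) (s : ℕ) (y d : ℤ) :
    pairStayProb ρ s (y + 2 * d) y ≤ stayProb s (y + 2 * d) * stayProb s y +
      ∑ i ∈ Finset.range s, (8 / ((s - 1 - i : ℕ) + 1) : ℝ) * returnProb ((1 - ρ) / 2) i d := by
  have hδ0 : 0 ≤ (1 - ρ) / 2 := by linarith
  have hδ1 : (1 - ρ) / 2 ≤ 1 / 2 := by linarith
  induction s generalizing y d with
  | zero => simp only [pairStayProb, stayProb]; split_ifs <;> simp_all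
  | succ s ih =>
    -- Half the difference of the walks is the sticky walk, which leaves `0` with this probability.
    set δ := (1 - ρ) / 2 with hδ
    set Q : ℤ → ℝ := fun d => ∑ i ∈ Finset.range s,
      (8 / ((s - 1 - i : ℕ) + 1) : ℝ) * returnProb δ i d with hQ
    have hsum : ∑ i ∈ Finset.range (s + 1),
        (8 / ((s + 1 - 1 - i : ℕ) + 1) : ℝ) * returnProb δ i d =
        stickyStep δ Q d + 8 / ((s : ℝ) + 1) * returnProb δ 0 d := by
      rw [Finset.sum_range_succ', hQ, stickyStep_sum]
      congr 1
      refine Finset.sum_congr rfl fun i _ => ?_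
      rw [show s + 1 - 1 - (i + 1) = s - 1 - i by omega]
      rfl
    have hpos : 0 ≤ ∑ i ∈ Finset.range (s + 1),
        (8 / ((s + 1 - 1 - i : ℕ) + 1) : ℝ) * returnProb δ i d :=
      Finset.sum_nonneg fun i _ => mul_nonneg (by positivity) (returnProb_nonneg hδ0 hδ1 i d)
    by_cases hxy : 0 ≤ y + 2 * d ∧ 0 ≤ y
    swap
    · rw [pairStayProb, if_neg hxy]
      exact add_nonneg (mul_nonneg (stayProb_nonneg _ _) (stayProb_nonneg _ _)) hpos
    rw [hsum, pairStayProb, if_pos hxy, stayProb_succ _ hxy.1, stayProb_succ _ hxy.2]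
    have pp := ih (y + 1) d
    have mm := ih (y - 1) d
    have pm := ih (y - 1) (d + 1)
    have mp := ih (y + 1) (d - 1)
    rw [show y + 1 + 2 * d = y + 2 * d + 1 by ring] at pp
    rw [show y - 1 + 2 * d = y + 2 * d - 1 by ring] at mm
    rw [show y - 1 + 2 * (d + 1) = y + 2 * d + 1 by ring] at pm
    rw [show y + 1 + 2 * (d - 1) = y + 2 * d - 1 by ring] at mp
    change _ ≤ _ + Q d at pp
    change _ ≤ _ + Q d at mm
    change _ ≤ _ + Q (d + 1) at pm
    change _ ≤ _ + Q (d - 1) at mp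
    -- At a meeting, with `a, b` the values of `stayProb s` at `y ± 1`, the product has mean `((a +
    -- b) / 2) ^ 2 + ρ * ((a - b) / 2) ^ 2`; the second term is the new covariance. Apart, the mean
    -- factorises.
    by_cases hd : d = 0
    · subst hd
      have hg := stayProb_gradient_sq_le s hxy.2
      simp only [mul_zero, add_zero, zero_add, zero_sub, if_true, stickyStep, returnProb] at *
      have a := mul_le_mul_of_nonneg_left (add_le_add pp mm) (by linarith : 0 ≤ (1 + ρ) / 4)
      have b := mul_le_mul_of_nonneg_left (add_le_add pm mp) (by linarith : 0 ≤ (1 - ρ) / 4)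
      have c := mul_le_mul_of_nonneg_right h1
        (sq_nonneg ((stayProb s (y + 1) - stayProb s (y - 1)) / 2))
      rw [hδ]
      linarith
    · rw [if_neg (by omega)]
      simp only [stickyStep, returnProb, if_neg hd]
      linarith

/-- Quantitative decorrelation of the events that two walks from the same point stay
nonnegative. -/
lemma pairStayProb_self_le {ρ : ℝ} (h0 : 0 ≤ ρ) (h1 : ρ < 1) {n : ℕ} (hn : 0 < n) (x : ℤ) :
    pairStayProb ρ n x x ≤ stayProb n x ^ 2 + 16 * (1 + Real.log n) / (√n * (1 - ρ)) := by
  set δ := (1 - ρ) / 2 with hδ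
  have hδ0 : 0 < δ := by rw [hδ]; linarith
  have hδ1 : δ ≤ 1 / 2 := by rw [hδ]; linarith
  have h := pairStayProb_le h0 h1.le n x 0
  rw [mul_zero, add_zero, ← sq, ← hδ] at h
  refine h.trans (add_le_add_right ?_ _)
  -- Meeting probabilities decrease in `i` and the weights increase, so Chebyshev's sum inequality
  -- separates the expected number of meetings from a harmonic sum.
  have hanti : AntivaryOn (fun i => returnProb δ i 0)
      (fun i => (8 / ((n - 1 - i : ℕ) + 1) : ℝ)) (Finset.range n : Set ℕ) := by
    refine AntitoneOn.antivaryOn ((returnProb_zero_antitone hδ0.le hδ1).antitoneOn _) ?_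
    intro i _ j _ hij
    dsimp only
    gcongr
  have hcheb := hanti.card_mul_sum_le_sum_mul_sum
  rw [Finset.card_range] at hcheb
  have hharm : ∑ i ∈ Finset.range n, (8 / ((n - 1 - i : ℕ) + 1) : ℝ) ≤ 8 * (1 + Real.log n) := by
    rw [Finset.sum_range_reflect (fun i => (8 / ((i : ℕ) + 1) : ℝ)) n]
    have := harmonic_le_one_add_log n
    rw [harmonic] at this
    push_cast at this
    calc ∑ i ∈ Finset.range n, (8 / ((i : ℕ) + 1) : ℝ)
        = 8 * ∑ i ∈ Finset.range n, ((i : ℝ) + 1)⁻¹ := by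
          rw [Finset.mul_sum]; rfl
      _ ≤ _ := by linarith
  have hn' : (0 : ℝ) < n := by exact_mod_cast hn
  have hlog : 0 ≤ Real.log n := Real.log_natCast_nonneg n
  have hq := sum_returnProb_le hδ0 hδ1 n
  have hq0 : 0 ≤ ∑ i ∈ Finset.range n, returnProb δ i 0 :=
    Finset.sum_nonneg fun i _ => returnProb_nonneg hδ0.le hδ1 i 0
  have hs : 0 < √(n : ℝ) := Real.sqrt_pos.2 hn'
  have hsq : √(n : ℝ) * √n = n := Real.mul_self_sqrt hn'.le
  have hprod : (n : ℝ) * ∑ i ∈ Finset.range n,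
      (8 / ((n - 1 - i : ℕ) + 1) : ℝ) * returnProb δ i 0 ≤ √n / δ * (8 * (1 + Real.log n)) := by
    calc _ = (n : ℝ) * ∑ i ∈ Finset.range n,
          returnProb δ i 0 * (8 / ((n - 1 - i : ℕ) + 1) : ℝ) := by
            simp_rw [mul_comm (returnProb δ _ 0)]
      _ ≤ _ := hcheb
      _ ≤ √n / δ * (8 * (1 + Real.log n)) := by gcongr
  have hfin : √n / δ * (8 * (1 + Real.log n)) =
      n * (16 * (1 + Real.log n) / (√n * (1 - ρ))) := by
    have : 1 - ρ ≠ 0 := by linarith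
    rw [hδ]
    field_simp
    nlinarith
  rw [hfin] at hprod
  exact le_of_mul_le_mul_left hprod hn'

lemma pairStayProb_nonneg {ρ : ℝ} (h0 : 0 ≤ ρ) (h1 : ρ ≤ 1) (s : ℕ) (x y : ℤ) :
    0 ≤ pairStayProb ρ s x y := by
  induction s generalizing x y with
  | zero => simp only [pairStayProb]; split_ifs <;> norm_num
  | succ s ih =>
    have a := ih (x + 1) (y + 1)
    have b := ih (x - 1) (y - 1)
    have c := ih (x + 1) (y - 1)
    have d := ih (x - 1) (y + 1)
    have hp : 0 ≤ (1 + ρ) / 4 := by linarith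
    have hm : 0 ≤ (1 - ρ) / 4 := by linarith
    simp only [pairStayProb]
    split_ifs <;> positivity

lemma pairStayProb_le_stayProb {ρ : ℝ} (h0 : 0 ≤ ρ) (h1 : ρ ≤ 1) (s : ℕ) (x y : ℤ) :
    pairStayProb ρ s x y ≤ stayProb s x := by
  induction s generalizing x y with
  | zero => simp only [pairStayProb, stayProb]; split_ifs <;> simp_all
  | succ s ih =>
    have a := ih (x + 1) (y + 1)
    have b := ih (x - 1) (y - 1)
    have c := ih (x + 1) (y - 1)
    have d := ih (x - 1) (y + 1)
    by_cases hxy : 0 ≤ x ∧ 0 ≤ y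
    swap
    · rw [pairStayProb, if_neg hxy]; exact stayProb_nonneg _ _
    rw [pairStayProb, if_pos hxy, stayProb_succ _ hxy.1]
    split_ifs
    · have e := mul_le_mul_of_nonneg_left (add_le_add a b) (by linarith : 0 ≤ (1 + ρ) / 4)
      have f := mul_le_mul_of_nonneg_left (add_le_add c d) (by linarith : 0 ≤ (1 - ρ) / 4)
      linarith
    · linarith

/-! ### The product over scales -/

/-- If the events of scale `k` have probabilities close to `1` and their correlation decays
geometrically, from the scale `Δ ^ (-O(1))` on, then the second moment costs a factor `Δ ^ (-1/2)`
only. -/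
lemma prod_le_of_decorrelation {p v : ℕ → ℝ} {C Δ : ℝ} (hC : 0 ≤ C) (hΔ0 : 0 < Δ) (hΔ1 : Δ ≤ 1)
    (hp : ∀ k, 15 / 16 ≤ p k) (hv0 : ∀ k, 0 ≤ v k)
    (hvp : ∀ k, v k ≤ p k) (hv : ∀ k, v k ≤ p k ^ 2 + C * (3 / 4) ^ k / Δ) (n : ℕ) :
    ∏ k ∈ Finset.range n, v k ≤
      2 * Real.exp (8 * C) / √Δ * (∏ k ∈ Finset.range n, p k) ^ 2 := by
  -- From `15 / 16 ≤ p`, full correlation costs at most a factor `16 / 15` per scale.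
  have crude : ∀ n, ∏ k ∈ Finset.range n, v k ≤
      (16 / 15) ^ n * (∏ k ∈ Finset.range n, p k) ^ 2 := by
    intro n
    rw [← Finset.prod_pow]
    calc ∏ k ∈ Finset.range n, v k ≤ ∏ k ∈ Finset.range n, (16 / 15 * p k ^ 2) := by
          refine Finset.prod_le_prod (fun k _ => hv0 k) fun k _ => (hvp k).trans ?_
          nlinarith [hp k]
      _ = _ := by rw [Finset.prod_mul_distrib, Finset.prod_const, Finset.card_range]
  -- Here `(3 / 4) ^ (m + 1) < Δ ≤ (3 / 4) ^ m`. Since `(16 / 15) ^ 2 ≤ 4 / 3`, the crude factor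
  -- over `m + 1` scales is at most `2 / √Δ`.
  obtain ⟨m, hm1, hm2⟩ := exists_nat_pow_near_of_lt_one hΔ0 hΔ1 (by norm_num : (0 : ℝ) < 3 / 4)
    (by norm_num)
  have hsq : √Δ ^ 2 = Δ := Real.sq_sqrt hΔ0.le
  have hs : 0 < √Δ := Real.sqrt_pos.2 hΔ0
  have hpow : ((16 : ℝ) / 15) ^ (m + 1) ≤ 2 / √Δ := by
    refine le_of_sq_le_sq ?_ (by positivity)
    rw [div_pow 2, hsq]
    have h1 : (((16 : ℝ) / 15) ^ (m + 1)) ^ 2 ≤ (4 / 3) ^ (m + 1) := by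
      rw [← pow_mul, mul_comm, pow_mul]
      exact pow_le_pow_left₀ (by norm_num) (by norm_num) _
    have h2 : ((4 : ℝ) / 3) ^ m ≤ 1 / Δ := by
      rw [le_div_iff₀ hΔ0]
      calc ((4 : ℝ) / 3) ^ m * Δ ≤ (4 / 3) ^ m * (3 / 4) ^ m := by gcongr
        _ = 1 := by rw [← mul_pow]; norm_num
    calc (((16 : ℝ) / 15) ^ (m + 1)) ^ 2 ≤ (4 / 3) ^ m * (4 / 3) := h1.trans_eq (pow_succ _ _)
      _ ≤ 1 / Δ * (4 / 3) := by gcongr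
      _ ≤ 2 ^ 2 / Δ := by rw [one_div_mul_eq_div]; gcongr; norm_num
  have hexp : 1 ≤ Real.exp (8 * C) := Real.one_le_exp (by positivity)
  rcases le_or_gt n (m + 1) with hn | hn
  · refine (crude n).trans ?_
    gcongr
    calc ((16 : ℝ) / 15) ^ n ≤ (16 / 15) ^ (m + 1) := pow_le_pow_right₀ (by norm_num) hn
      _ ≤ 2 / √Δ := hpow
      _ ≤ 2 * Real.exp (8 * C) / √Δ := by gcongr; linarith
  · obtain ⟨j, rfl⟩ : ∃ j, n = m + 1 + j := ⟨n - (m + 1), by omega⟩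
    rw [Finset.prod_range_add v (m + 1) j, Finset.prod_range_add p (m + 1) j]
    have tail : ∏ k ∈ Finset.range j, v (m + 1 + k) ≤
        Real.exp (8 * C) * (∏ k ∈ Finset.range j, p (m + 1 + k)) ^ 2 := by
      rw [← Finset.prod_pow]
      calc ∏ k ∈ Finset.range j, v (m + 1 + k)
          ≤ ∏ k ∈ Finset.range j, (Real.exp (2 * C * (3 / 4) ^ k) * p (m + 1 + k) ^ 2) := by
            refine Finset.prod_le_prod (fun k _ => hv0 _) fun k _ => (hv _).trans ?_
            have e1 : C * (3 / 4) ^ (m + 1 + k) / Δ ≤ C * (3 / 4) ^ k := by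
              rw [div_le_iff₀ hΔ0, pow_add]
              calc C * ((3 / 4) ^ (m + 1) * (3 / 4) ^ k) ≤ C * (Δ * (3 / 4) ^ k) := by gcongr
                _ = _ := by ring
            -- As `1 / 2 ≤ p ^ 2`, the additive error becomes a factor `1 + 2 * C * (3 / 4) ^ k`;
            -- the geometric series, at most `4`, yields `exp (8 * C)`.
            have e2 := Real.add_one_le_exp (2 * C * (3 / 4) ^ k)
            have e3 : 1 / 2 ≤ p (m + 1 + k) ^ 2 := by nlinarith [hp (m + 1 + k)]
            have e4 : 0 ≤ C * (3 / 4) ^ k := by positivity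
            nlinarith
        _ = Real.exp (2 * C * ∑ k ∈ Finset.range j, (3 / 4) ^ k) *
            ∏ k ∈ Finset.range j, p (m + 1 + k) ^ 2 := by
            rw [Finset.prod_mul_distrib, ← Real.exp_sum, Finset.mul_sum]
        _ ≤ _ := by
            have : ∑ k ∈ Finset.range j, ((3 : ℝ) / 4) ^ k ≤ 4 := by
              rw [geom_sum_eq (by norm_num)]
              have : (0 : ℝ) < (3 / 4) ^ j := by positivity
              rw [div_le_iff_of_neg (by norm_num)]
              linarith
            have h8 : 2 * C * ∑ k ∈ Finset.range j, ((3 : ℝ) / 4) ^ k ≤ 8 * C := by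
              nlinarith [mul_le_mul_of_nonneg_left this hC]
            exact mul_le_mul_of_nonneg_right (Real.exp_le_exp.2 h8)
              (Finset.prod_nonneg fun k _ => sq_nonneg _)
    calc _ ≤ (16 / 15) ^ (m + 1) * (∏ k ∈ Finset.range (m + 1), p k) ^ 2 *
          (Real.exp (8 * C) * (∏ k ∈ Finset.range j, p (m + 1 + k)) ^ 2) :=
            mul_le_mul (crude _) tail (Finset.prod_nonneg fun k _ => hv0 _) (by positivity)
      _ ≤ 2 / √Δ * (∏ k ∈ Finset.range (m + 1), p k) ^ 2 *
          (Real.exp (8 * C) * (∏ k ∈ Finset.range j, p (m + 1 + k)) ^ 2) := by gcongr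
      _ = _ := by ring

/-- The barrier depth `4 · 2 ^ (k + 1)` of scale `k`, whose duration is `4 ^ (k + 1)`. -/
def scaleDepth (k : ℕ) : ℕ := 4 * 2 ^ (k + 1)

/-- The factor `4` in the depth lets Kolmogorov's inequality give failure probability `1 / 16`,
small enough for the crude bound to stay integrable in `Δ`. -/
lemma le_stayProb_scale (k : ℕ) : 15 / 16 ≤ stayProb (4 ^ (k + 1)) (scaleDepth k) := by
  have h := one_sub_stayProb_le (scaleDepth k) (4 ^ (k + 1)) (scaleDepth k) (by omega)
  have e : ((((scaleDepth k : ℕ) : ℤ) : ℝ) - (scaleDepth k : ℕ)) ^ 2 = 0 := by simp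
  rw [e, zero_add] at h
  have : ((4 ^ (k + 1) : ℕ) : ℝ) / ((scaleDepth k : ℝ) + 1) ^ 2 ≤ 1 / 16 := by
    rw [div_le_div_iff₀ (by positivity) (by norm_num)]
    have e4 : (4 : ℝ) ^ (k + 1) = (2 ^ (k + 1)) ^ 2 := by
      rw [← pow_mul, mul_comm, pow_mul]; norm_num
    unfold scaleDepth
    push_cast
    rw [e4]
    have : (0 : ℝ) < 2 ^ (k + 1) := by positivity
    nlinarith
  linarith

lemma two_mul_add_three_le (k : ℕ) : (2 * k + 3 : ℝ) ≤ 4 * (3 / 2) ^ k := by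
  induction k with
  | zero => norm_num
  | succ k ih =>
    rw [pow_succ]
    rcases Nat.eq_zero_or_pos k with rfl | hk
    · norm_num
    · have : (1 : ℝ) ≤ k := by exact_mod_cast hk
      push_cast
      linarith

/-- For `n = 4 ^ (k + 1)` the error is of order `k * 2 ^ (-k) / Δ`; the ratio `3 / 4` instead of `1
/ 2` absorbs the logarithm. -/
lemma pairStayProb_scale_le {Δ : ℝ} (h0 : 0 < Δ) (h1 : Δ ≤ 1) (k : ℕ) :
    pairStayProb (Real.exp (-Δ)) (4 ^ (k + 1)) (scaleDepth k) (scaleDepth k) ≤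
      stayProb (4 ^ (k + 1)) (scaleDepth k) ^ 2 + 64 * (3 / 4) ^ k / Δ := by
  have hρ : Real.exp (-Δ) ≤ 1 - Δ / 2 := by
    have h2 := Real.add_one_le_exp Δ
    have h3 : Real.exp (-Δ) * Real.exp Δ = 1 := by rw [← Real.exp_add]; simp
    have h4 := Real.exp_pos (-Δ)
    have h5 : Real.exp (-Δ) * (Δ + 1) ≤ 1 := by nlinarith
    have h6 : (1 : ℝ) ≤ (1 - Δ / 2) * (Δ + 1) := by nlinarith
    exact le_of_mul_le_mul_right (h5.trans h6) (by linarith)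
  refine (pairStayProb_self_le (Real.exp_pos _).le (by linarith)
    (show 0 < 4 ^ (k + 1) by positivity) _).trans (add_le_add_right ?_ _)
  have hlog : Real.log ((4 ^ (k + 1) : ℕ) : ℝ) ≤ 2 * (k + 1) := by
    push_cast
    rw [Real.log_pow, show (4 : ℝ) = 2 ^ 2 by norm_num, Real.log_pow]
    have := Real.log_two_lt_d9
    push_cast
    nlinarith [(Nat.cast_nonneg k : (0 : ℝ) ≤ k)]
  have hs : √((4 ^ (k + 1) : ℕ) : ℝ) = 2 ^ (k + 1) := by
    rw [Real.sqrt_eq_iff_mul_self_eq (by positivity) (by positivity)]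
    push_cast
    rw [← mul_pow]; norm_num
  rw [hs]
  calc 16 * (1 + Real.log ((4 ^ (k + 1) : ℕ) : ℝ)) / (2 ^ (k + 1) * (1 - Real.exp (-Δ)))
      ≤ 16 * (2 * k + 3) / (2 ^ (k + 1) * (Δ / 2)) := by
        have e1 : 1 + Real.log ((4 ^ (k + 1) : ℕ) : ℝ) ≤ 2 * k + 3 := by linarith
        have e2 : Δ / 2 ≤ 1 - Real.exp (-Δ) := by linarith
        gcongr
    _ ≤ 16 * (4 * (3 / 2) ^ k) / (2 ^ (k + 1) * (Δ / 2)) := by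
        gcongr; exact two_mul_add_three_le k
    _ = 64 * (3 / 4) ^ k / Δ := by
        rw [show (3 : ℝ) / 4 = (3 / 2) / 2 by norm_num, div_pow (3 / 2 : ℝ) 2 k, pow_succ]
        field_simp
        norm_num

lemma prod_pairStayProb_scale_le {Δ : ℝ} (h0 : 0 < Δ) (h1 : Δ ≤ 1) (n : ℕ) :
    ∏ k ∈ Finset.range n,
        pairStayProb (Real.exp (-Δ)) (4 ^ (k + 1)) (scaleDepth k) (scaleDepth k) ≤
      2 * Real.exp 512 / √Δ *
        (∏ k ∈ Finset.range n, stayProb (4 ^ (k + 1)) (scaleDepth k)) ^ 2 := by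
  have hρ : Real.exp (-Δ) ≤ 1 := Real.exp_le_one_iff.2 (by linarith)
  have := prod_le_of_decorrelation (C := 64) (by norm_num) h0 h1 le_stayProb_scale
    (fun k => pairStayProb_nonneg (Real.exp_pos _).le hρ _ _ _)
    (fun k => pairStayProb_le_stayProb (Real.exp_pos _).le hρ _ _ _)
    (pairStayProb_scale_le h0 h1) n
  norm_num at this ⊢
  exact this

/-- Not needed for the second moment: it shows that a fixed time is almost surely not exceptional,
which rules out ring times. -/
lemma exists_stayProb_scale_le : ∃ q : ℝ, 0 ≤ q ∧ q < 1 ∧ ∃ k₁ : ℕ, ∀ k, k₁ ≤ k →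
    stayProb (4 ^ (k + 1)) (scaleDepth k) ≤ q := by
  obtain ⟨q, h0, h1, k₁, h⟩ := exists_stayProb_le 4
  exact ⟨q, h0, h1, k₁, fun k hk => h (k + 1) (by omega)⟩

/-! ### Independence -/

namespace DynamicalDiscreteWeb

variable {Ω : Type*} [mΩ : MeasurableSpace Ω] {P : Measure Ω} (W : DynamicalDiscreteWeb P)

/-- The σ-algebras generated by the single waiting times (left) and arrows (right). -/
@[reducible] def atomSigma : (EvenSite × ℕ) ⊕ (EvenSite × ℕ) → MeasurableSpace Ω
  | Sum.inl i => MeasurableSpace.comap (W.wait i.1 i.2) inferInstance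
  | Sum.inr i => MeasurableSpace.comap (W.arrow i.1 i.2) inferInstance

/-- The σ-algebra generated by a set of waiting times and arrows. -/
@[reducible] def sigmaOf (J : Set ((EvenSite × ℕ) ⊕ (EvenSite × ℕ))) : MeasurableSpace Ω :=
  ⨆ j ∈ J, W.atomSigma j

/-- The σ-algebra generated by all waiting times and arrows at the sites of `S`. -/
@[reducible] def siteSigma (S : Set EvenSite) : MeasurableSpace Ω :=
  W.sigmaOf {j | Sum.elim Prod.fst Prod.fst j ∈ S}

lemma atomSigma_le (j : (EvenSite × ℕ) ⊕ (EvenSite × ℕ)) : W.atomSigma j ≤ mΩ := by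
  rcases j with i | i
  · exact (W.measurable_wait i.1 i.2).comap_le
  · exact (W.measurable_arrow i.1 i.2).comap_le

lemma sigmaOf_le (J : Set ((EvenSite × ℕ) ⊕ (EvenSite × ℕ))) : W.sigmaOf J ≤ mΩ :=
  iSup₂_le fun j _ => W.atomSigma_le j

lemma siteSigma_le (S : Set EvenSite) : W.siteSigma S ≤ mΩ := W.sigmaOf_le _

lemma sigmaOf_mono {J J' : Set ((EvenSite × ℕ) ⊕ (EvenSite × ℕ))} (h : J ⊆ J') :
    W.sigmaOf J ≤ W.sigmaOf J' := biSup_mono h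

lemma siteSigma_mono {S T : Set EvenSite} (h : S ⊆ T) : W.siteSigma S ≤ W.siteSigma T :=
  W.sigmaOf_mono fun _ hj => h hj

lemma measurable_sigmaOf_wait {J : Set ((EvenSite × ℕ) ⊕ (EvenSite × ℕ))} {z : EvenSite} {n : ℕ}
    (h : Sum.inl (z, n) ∈ J) : Measurable[W.sigmaOf J] (W.wait z n) :=
  (comap_measurable _).mono (le_biSup W.atomSigma h) le_rfl

lemma measurable_sigmaOf_arrow {J : Set ((EvenSite × ℕ) ⊕ (EvenSite × ℕ))} {z : EvenSite} {n : ℕ}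
    (h : Sum.inr (z, n) ∈ J) : Measurable[W.sigmaOf J] (W.arrow z n) :=
  (comap_measurable _).mono (le_biSup W.atomSigma h) le_rfl

/-- A finite intersection splits into a waiting-time part and an arrow part, independent of each
other; each then factorises within its family. -/
lemma iIndep_atomSigma : iIndep W.atomSigma P := by
  rw [iIndep_iff]
  intro s f hf
  obtain ⟨a, b, rfl⟩ : ∃ a b : Finset (EvenSite × ℕ), s = a.disjSum b :=
    ⟨s.toLeft, s.toRight, s.toLeft_disjSum_toRight.symm⟩
  have hsplit : ⋂ i ∈ a.disjSum b, f i =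
      (⋂ i ∈ a, f (Sum.inl i)) ∩ ⋂ i ∈ b, f (Sum.inr i) := by
    ext ω; simp
  have ha : ∀ i ∈ a, MeasurableSet[W.atomSigma (Sum.inl i)] (f (Sum.inl i)) :=
    fun i hi => hf _ (by simpa using hi)
  have hb : ∀ i ∈ b, MeasurableSet[W.atomSigma (Sum.inr i)] (f (Sum.inr i)) :=
    fun i hi => hf _ (by simpa using hi)
  rw [hsplit, Finset.prod_disjSum]
  rw [← (iIndepFun_iff _ _ _).1 W.indep_wait a (f' := fun i => f (Sum.inl i)) ha,
    ← (iIndepFun_iff _ _ _).1 W.indep_arrow b (f' := fun i => f (Sum.inr i)) hb]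
  refine (IndepFun_iff _ _ _).1 W.indep_wait_arrow _ _ ?_ ?_
  · refine Finset.measurableSet_biInter a fun i hi => ?_
    have hle : W.atomSigma (Sum.inl i) ≤ MeasurableSpace.comap
        (fun ω (i : EvenSite × ℕ) => W.wait i.1 i.2 ω) inferInstance := by
      refine Measurable.comap_le ?_
      exact (measurable_pi_apply (X := fun _ : EvenSite × ℕ => ℝ) i).comp (comap_measurable
        (fun ω (i : EvenSite × ℕ) => W.wait i.1 i.2 ω))
    exact hle _ (ha i hi)
  · refine Finset.measurableSet_biInter b fun i hi => ?_
    have hle : W.atomSigma (Sum.inr i) ≤ MeasurableSpace.comap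
        (fun ω (i : EvenSite × ℕ) => W.arrow i.1 i.2 ω) inferInstance := by
      refine Measurable.comap_le ?_
      exact (measurable_pi_apply (X := fun _ : EvenSite × ℕ => Bool) i).comp (comap_measurable
        (fun ω (i : EvenSite × ℕ) => W.arrow i.1 i.2 ω))
    exact hle _ (hb i hi)

lemma indep_sigmaOf {J J' : Set ((EvenSite × ℕ) ⊕ (EvenSite × ℕ))} (h : Disjoint J J') :
    Indep (W.sigmaOf J) (W.sigmaOf J') P :=
  indep_iSup_of_disjoint W.atomSigma_le W.iIndep_atomSigma h

lemma indep_siteSigma {S T : Set EvenSite} (h : Disjoint S T) :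
    Indep (W.siteSigma S) (W.siteSigma T) P := by
  refine W.indep_sigmaOf ?_
  rw [Set.disjoint_left] at *
  exact fun j hj => h hj

/-! ### Clocks -/

/-- The time of the `n`-th ring of the clock at `z`, and `0` for `n = 0`. -/
def clock (z : EvenSite) (n : ℕ) (ω : Ω) : ℝ := ∑ i ∈ Finset.range n, W.wait z i ω

lemma ringTime_eq_clock (z : EvenSite) (n : ℕ) (ω : Ω) :
    W.ringTime z n ω = W.clock z (n + 1) ω := rfl

lemma clock_succ (z : EvenSite) (n : ℕ) (ω : Ω) :
    W.clock z (n + 1) ω = W.clock z n ω + W.wait z n ω := Finset.sum_range_succ _ _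

/-- The regularity of a clock that holds almost surely. -/
def GoodClock (z : EvenSite) (ω : Ω) : Prop :=
  (∀ n, 0 < W.wait z n ω) ∧ ∀ τ : ℝ, ∃ n, τ < W.clock z n ω

variable {W}

lemma GoodClock.strictMono {z : EvenSite} {ω : Ω} (h : W.GoodClock z ω) :
    StrictMono fun n => W.clock z n ω :=
  strictMono_nat_of_lt_succ fun n => by rw [clock_succ]; linarith [h.1 n]

lemma GoodClock.finite {z : EvenSite} {ω : Ω} (h : W.GoodClock z ω) (τ : ℝ) :
    {n : ℕ | W.ringTime z n ω ≤ τ}.Finite := by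
  obtain ⟨n, hn⟩ := h.2 τ
  refine (Set.finite_lt_nat n).subset fun m hm => ?_
  have : W.clock z (m + 1) ω < W.clock z n ω := lt_of_le_of_lt hm hn
  have := h.strictMono.lt_iff_lt.1 this
  simp only [Set.mem_ofPred_eq]
  omega

/-- The rings up to `τ` form an initial segment of `ℕ`, so the `ncard` is a genuine count and not
the default value of an infinite set. -/
lemma GoodClock.ringCount_eq_iff {z : EvenSite} {ω : Ω} (h : W.GoodClock z ω) {τ : ℝ}
    (hτ : 0 ≤ τ) (n : ℕ) :
    W.ringCount z τ ω = n ↔ W.clock z n ω ≤ τ ∧ τ < W.clock z (n + 1) ω := by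
  have key : ∀ m, W.clock z m ω ≤ τ → τ < W.clock z (m + 1) ω → W.ringCount z τ ω = m := by
    intro m h1 h2
    have : {k : ℕ | W.ringTime z k ω ≤ τ} = Set.Iio m := by
      ext k
      simp only [Set.mem_ofPred_eq, Set.mem_Iio, ringTime_eq_clock]
      constructor
      · intro hk
        have := h.strictMono.lt_iff_lt.1 (hk.trans_lt h2)
        omega
      · intro hk
        exact (h.strictMono.monotone (show k + 1 ≤ m from hk)).trans h1
    rw [ringCount, this, Set.ncard_eq_toFinset_card']
    simp
  refine ⟨?_, fun hn => key n hn.1 hn.2⟩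
  rintro rfl
  classical
  have hex := h.2 τ
  -- Since `clock z 0 = 0 ≤ τ`, the first clock value beyond `τ` has positive index.
  obtain ⟨m, hm⟩ : ∃ m, Nat.find hex = m + 1 := by
    refine Nat.exists_eq_succ_of_ne_zero fun h0 => ?_
    have := Nat.find_spec hex
    rw [h0] at this
    simp [clock] at this
    linarith
  have h2 := Nat.find_spec hex
  rw [hm] at h2
  have h1 := not_lt.1 (Nat.find_min hex (show m < Nat.find hex by omega))
  rw [key m h1 h2]
  exact ⟨h1, h2⟩

variable (W)

end DynamicalDiscreteWeb

/-! ### The exponential law and null sets at random times -/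

lemma expMeasure_one_Iic {a : ℝ} (ha : 0 ≤ a) :
    expMeasure 1 (Set.Iic a) = ENNReal.ofReal (1 - Real.exp (-a)) := by
  have : IsProbabilityMeasure (expMeasure 1) := isProbabilityMeasure_expMeasure one_pos
  rw [← ofReal_cdf, cdf_expMeasure_eq one_pos, if_pos ha, one_mul]

lemma expMeasure_one_Ioi {a : ℝ} (ha : 0 ≤ a) :
    expMeasure 1 (Set.Ioi a) = ENNReal.ofReal (Real.exp (-a)) := by
  have : IsProbabilityMeasure (expMeasure 1) := isProbabilityMeasure_expMeasure one_pos
  rw [← Set.compl_Iic, prob_compl_eq_one_sub measurableSet_Iic, expMeasure_one_Iic ha,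
    ← ENNReal.ofReal_one, ← ENNReal.ofReal_sub _ (by simpa using ha)]
  congr 1; ring

lemma expMeasure_one_singleton (a : ℝ) : expMeasure 1 {a} = 0 := by
  rw [expMeasure, gammaMeasure]
  exact withDensity_absolutelyContinuous _ _ (by simp)

lemma measurable_ncard_setOf {α : Type*} [MeasurableSpace α] {p : ℕ → α → Prop}
    (h : ∀ n, MeasurableSet {a | p n a}) : Measurable fun a => {n | p n a}.ncard :=
  measurable_ncard.comp (measurable_set_iff.2 fun n => measurableSet_setOfPred.1 (h n))

/-- Fubini for the joint law, which independence makes a product. -/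
lemma ProbabilityTheory.IndepFun.measure_prod_eq_zero {Ω β : Type*} [MeasurableSpace Ω]
    [MeasurableSpace β] {P : Measure Ω} [IsProbabilityMeasure P] {T : Ω → ℝ} {Y : Ω → β}
    (hT : Measurable T) (hY : Measurable Y) (hind : IndepFun T Y P) {D : Set (ℝ × β)}
    (hD : MeasurableSet D) (h0 : ∀ t, P {ω | (t, Y ω) ∈ D} = 0) :
    P {ω | (T ω, Y ω) ∈ D} = 0 := by
  have hmap := (indepFun_iff_map_prod_eq_prod_map_map hT.aemeasurable hY.aemeasurable).1 hind
  have e : P {ω | (T ω, Y ω) ∈ D} = P.map (fun ω => (T ω, Y ω)) D := by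
    rw [Measure.map_apply (hT.prodMk hY) hD]; rfl
  rw [e, hmap, Measure.prod_apply hD]
  refine lintegral_eq_zero_of_ae_eq_zero (Filter.Eventually.of_forall fun t => ?_)
  change P.map Y (Prod.mk t ⁻¹' D) = 0
  rw [Measure.map_apply hY (measurable_prodMk_left hD)]
  exact h0 t

/-- A random time does not hit the null sections of a set that is independent of it. -/
lemma measure_graph_eq_zero {Ω : Type*} {m₁ m₂ mΩ : MeasurableSpace Ω} {P : Measure Ω}
    [IsProbabilityMeasure P] (h₁ : m₁ ≤ mΩ) (h₂ : m₂ ≤ mΩ)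
    (hind : Indep m₁ m₂ P) {T : Ω → ℝ} (hT : Measurable[m₁] T) {D : Set (ℝ × Ω)}
    (hD : MeasurableSet[(inferInstance : MeasurableSpace ℝ).prod m₂] D)
    (h0 : ∀ t, P {ω | (t, ω) ∈ D} = 0) : P {ω | (T ω, ω) ∈ D} = 0 := by
  refine @IndepFun.measure_prod_eq_zero Ω Ω mΩ m₂ P _ T id (hT.mono h₁ le_rfl)
    (measurable_id'' h₂) ?_ D hD h0
  refine (@IndepFun_iff_Indep Ω ℝ Ω mΩ _ m₂ T id P).2 ?_
  refine indep_of_indep_of_le_left (indep_of_indep_of_le_right hind ?_) hT.comap_le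
  exact (MeasurableSpace.comap_id).le

namespace DynamicalDiscreteWeb

variable {Ω : Type*} {m : MeasurableSpace Ω} [mΩ : MeasurableSpace Ω] {P : Measure Ω}
  (W : DynamicalDiscreteWeb P)

lemma measure_wait_preimage (z : EvenSite) (n : ℕ) {s : Set ℝ} (hs : MeasurableSet s) :
    P (W.wait z n ⁻¹' s) = expMeasure 1 s := by
  rw [← W.wait_law z n, Measure.map_apply (W.measurable_wait z n) hs]

lemma measurable_clock (z : EvenSite) (n : ℕ) : Measurable (W.clock z n) :=
  Finset.measurable_fun_sum _ fun i _ => W.measurable_wait z i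

/-- Among `n` independent waits none exceeds `N` with probability `r ^ n`, `r < 1`. One long wait
already pushes the clock past `N`, so no law of large numbers is needed. -/
lemma ae_exists_lt_wait (z : EvenSite) (N : ℕ) : ∀ᵐ ω ∂P, ∃ n, (N : ℝ) < W.wait z n ω := by
  rw [ae_iff]
  set r := ENNReal.ofReal (1 - Real.exp (-(N : ℝ))) with hr
  have hr1 : r < 1 := by
    rw [hr, ENNReal.ofReal_lt_one]
    linarith [Real.exp_pos (-(N : ℝ))]
  have hle : ∀ n, P {ω | ¬ ∃ n, (N : ℝ) < W.wait z n ω} ≤ r ^ n := by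
    intro n
    have hi := W.indep_wait.precomp (g := fun n : ℕ => (z, n)) (fun a b h => by simpa using h)
    have := hi.measure_inter_preimage_eq_mul (Finset.range n) (sets := fun _ => Set.Iic (N : ℝ))
      (fun _ _ => measurableSet_Iic)
    calc P {ω | ¬ ∃ n, (N : ℝ) < W.wait z n ω}
        ≤ P (⋂ i ∈ Finset.range n, (fun ω => W.wait z i ω) ⁻¹' Set.Iic (N : ℝ)) := by
          refine measure_mono fun ω hω => ?_
          simp only [Set.mem_ofPred_eq, not_exists, not_lt] at hω
          simp [hω]
      _ = _ := this
      _ = r ^ n := by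
          rw [Finset.prod_congr rfl fun i _ => W.measure_wait_preimage z i measurableSet_Iic]
          rw [Finset.prod_const, Finset.card_range, expMeasure_one_Iic (by positivity)]
  exact le_antisymm (ge_of_tendsto' (ENNReal.tendsto_pow_atTop_nhds_zero_of_lt_one hr1) hle)
    zero_le

lemma ae_goodClock : ∀ᵐ ω ∂P, ∀ z, W.GoodClock z ω := by
  have h1 : ∀ᵐ ω ∂P, ∀ z n, 0 < W.wait z n ω := by
    rw [ae_all_iff]; intro z
    rw [ae_all_iff]; intro n
    rw [ae_iff]
    have := W.measure_wait_preimage z n (measurableSet_Iic (a := (0 : ℝ)))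
    rw [expMeasure_one_Iic le_rfl] at this
    simpa [Set.preimage] using this
  have h2 : ∀ᵐ ω ∂P, ∀ z, ∀ N : ℕ, ∃ n, (N : ℝ) < W.wait z n ω := by
    rw [ae_all_iff]; intro z
    rw [ae_all_iff]; exact W.ae_exists_lt_wait z
  filter_upwards [h1, h2] with ω h1 h2 z
  refine ⟨h1 z, fun τ => ?_⟩
  obtain ⟨N, hN⟩ := exists_nat_gt τ
  obtain ⟨n, hn⟩ := h2 z N
  refine ⟨n + 1, ?_⟩
  have : 0 ≤ W.clock z n ω := Finset.sum_nonneg fun i _ => (h1 z i).le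
  rw [clock_succ]
  linarith

lemma indepFun_clock_wait (z : EvenSite) (n : ℕ) : IndepFun (W.clock z n) (W.wait z n) P := by
  rw [IndepFun_iff_Indep]
  have h : Disjoint {j : (EvenSite × ℕ) ⊕ (EvenSite × ℕ) | ∃ i < n, j = Sum.inl (z, i)}
      {Sum.inl (z, n)} := by
    rw [Set.disjoint_singleton_right]
    rintro ⟨i, hi, h⟩
    simp only [Sum.inl.injEq, Prod.mk.injEq] at h
    omega
  refine indep_of_indep_of_le_left (indep_of_indep_of_le_right (W.indep_sigmaOf h) ?_) ?_
  · exact (W.measurable_sigmaOf_wait (Set.mem_singleton _)).comap_le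
  · refine Measurable.comap_le ?_
    refine Finset.measurable_fun_sum _ fun i hi => W.measurable_sigmaOf_wait ?_
    exact ⟨i, Finset.mem_range.1 hi, rfl⟩

/-- Condition on the time `s` of the `n`-th ring: the next, independent wait must exceed `τ' - s`.
-/
lemma measure_clock_le_lt [IsProbabilityMeasure P] (z : EvenSite) (n : ℕ) {τ τ' : ℝ}
    (h : τ ≤ τ') :
    P {ω | W.clock z n ω ≤ τ ∧ τ' < W.clock z (n + 1) ω} =
      ∫⁻ s in Set.Iic τ, ENNReal.ofReal (Real.exp (-(τ' - s))) ∂(P.map (W.clock z n)) := by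
  have hmap := (indepFun_iff_map_prod_eq_prod_map_map (W.measurable_clock z n).aemeasurable
    (W.measurable_wait z n).aemeasurable).1 (W.indepFun_clock_wait z n)
  have hD : MeasurableSet {p : ℝ × ℝ | p.1 ≤ τ ∧ τ' < p.1 + p.2} :=
    (measurableSet_le measurable_fst measurable_const).inter
      (measurableSet_lt measurable_const (measurable_fst.add measurable_snd))
  have e : P {ω | W.clock z n ω ≤ τ ∧ τ' < W.clock z (n + 1) ω} =
      P.map (fun ω => (W.clock z n ω, W.wait z n ω)) {p : ℝ × ℝ | p.1 ≤ τ ∧ τ' < p.1 + p.2} := by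
    rw [Measure.map_apply ((W.measurable_clock z n).prodMk (W.measurable_wait z n)) hD]
    simp_rw [clock_succ]
    rfl
  have : IsProbabilityMeasure (P.map (W.wait z n)) :=
    Measure.isProbabilityMeasure_map (W.measurable_wait z n).aemeasurable
  rw [e, hmap, Measure.prod_apply hD, ← lintegral_indicator measurableSet_Iic]
  refine lintegral_congr fun s => ?_
  rw [W.wait_law]
  by_cases hs : s ≤ τ
  · rw [Set.indicator_of_mem (show s ∈ Set.Iic τ from hs), ← expMeasure_one_Ioi (by linarith)]
    congr 1
    ext w
    simp [hs, sub_lt_iff_lt_add']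
  · rw [Set.indicator_of_notMem (show s ∉ Set.Iic τ from hs)]
    convert measure_empty (μ := expMeasure 1)
    ext w
    simp [hs]

lemma measurable_ringCount {z : EvenSite}
    (h : ∀ n, Measurable[m] (W.wait z n)) :
    Measurable[(inferInstance : MeasurableSpace ℝ).prod m]
      (fun p : ℝ × Ω => W.ringCount z p.1 p.2) := by
  refine @measurable_ncard_setOf (ℝ × Ω) ((inferInstance : MeasurableSpace ℝ).prod m)
    (fun n p => W.ringTime z n p.2 ≤ p.1) fun n => ?_
  refine @measurableSet_le _ _ _ _ _ ((inferInstance : MeasurableSpace ℝ).prod m) _ _ _ _ _ ?_ ?_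
  · refine (Finset.measurable_fun_sum _ fun i _ => ?_)
    exact (h i).comp measurable_snd
  · exact measurable_fst

/-- Joint measurability in `(τ, ω)` serves both Fubini over dynamical time and the substitution of
random ring times. -/
lemma measurable_arrowAt {z : EvenSite}
    (h : ∀ n, Measurable[m] (W.wait z n)) (h' : ∀ n, Measurable[m] (W.arrow z n)) :
    Measurable[(inferInstance : MeasurableSpace ℝ).prod m]
      (fun p : ℝ × Ω => W.arrowAt p.1 p.2 z) := by
  have h1 := W.measurable_ringCount h
  have h2 : ∀ n, Measurable[(inferInstance : MeasurableSpace ℝ).prod m]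
    (fun p : ℝ × Ω => W.arrow z n p.2) := fun n => (h' n).comp measurable_snd
  let _ : MeasurableSpace (ℝ × Ω) := (inferInstance : MeasurableSpace ℝ).prod m
  have : Measurable fun q : ℕ × (ℝ × Ω) => W.arrow z q.1 q.2.2 :=
    measurable_from_prod_countable_right h2
  exact this.comp (h1.prodMk measurable_id)

lemma measurable_ringCount_of_time {z : EvenSite}
    (h : ∀ n, Measurable[m] (W.wait z n)) (τ : ℝ) : Measurable[m] (W.ringCount z τ) := by
  have h1 : Measurable[m, (inferInstance : MeasurableSpace ℝ).prod m] (Prod.mk τ : Ω → ℝ × Ω) :=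
    measurable_prodMk_left
  intro s hs
  exact h1 (W.measurable_ringCount h hs)

/-- The correlation of the arrows of a site at two dynamical times. -/
lemma measure_ringCount_eq [IsProbabilityMeasure P] (z : EvenSite) {τ τ' : ℝ} (h0 : 0 ≤ τ)
    (h : τ ≤ τ') :
    P {ω | W.ringCount z τ ω = W.ringCount z τ' ω} = ENNReal.ofReal (Real.exp (-(τ' - τ))) := by
  have hm : ∀ τ, Measurable (W.ringCount z τ) :=
    W.measurable_ringCount_of_time (W.measurable_wait z)
  -- Memorylessness: replacing `τ` by `τ'` in the integrand only extracts the factor `exp (-(τ' -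
  -- τ))`, the same for all `n`.
  have hn : ∀ n, P {ω | W.ringCount z τ ω = n ∧ W.ringCount z τ' ω = n} =
      ENNReal.ofReal (Real.exp (-(τ' - τ))) * P {ω | W.ringCount z τ ω = n} := by
    intro n
    have e1 : P {ω | W.ringCount z τ ω = n ∧ W.ringCount z τ' ω = n} =
        P {ω | W.clock z n ω ≤ τ ∧ τ' < W.clock z (n + 1) ω} := by
      refine measure_congr (Filter.eventuallyEq_set.2 ?_)
      filter_upwards [W.ae_goodClock] with ω hω
      simp only [(hω z).ringCount_eq_iff h0,
        (hω z).ringCount_eq_iff (h0.trans h)]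
      constructor
      · rintro ⟨⟨a, b⟩, c, d⟩; exact ⟨a, d⟩
      · rintro ⟨a, b⟩; exact ⟨⟨a, by linarith⟩, by linarith, b⟩
    have e2 : P {ω | W.ringCount z τ ω = n} =
        P {ω | W.clock z n ω ≤ τ ∧ τ < W.clock z (n + 1) ω} := by
      refine measure_congr (Filter.eventuallyEq_set.2 ?_)
      filter_upwards [W.ae_goodClock] with ω hω
      simp only [(hω z).ringCount_eq_iff h0]
    rw [e1, e2, W.measure_clock_le_lt z n h, W.measure_clock_le_lt z n le_rfl,
      ← lintegral_const_mul _ (by fun_prop)]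
    refine lintegral_congr fun s => ?_
    rw [← ENNReal.ofReal_mul (Real.exp_pos _).le, ← Real.exp_add]
    congr 2; ring
  have hU : {ω | W.ringCount z τ ω = W.ringCount z τ' ω} =
      ⋃ n, {ω | W.ringCount z τ ω = n ∧ W.ringCount z τ' ω = n} := by
    ext ω; simp [eq_comm]
  have hV : (Set.univ : Set Ω) = ⋃ n, {ω | W.ringCount z τ ω = n} := by
    ext ω; simp
  have hsum : ∑' n, P {ω | W.ringCount z τ ω = n} = 1 := by
    rw [← measure_iUnion, ← hV, measure_univ]
    · intro i j hij
      exact Set.disjoint_left.2 fun ω (h1 : _ = i) (h2 : _ = j) => hij (h1.symm.trans h2)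
    · exact fun n => hm τ (measurableSet_singleton n)
  rw [hU, measure_iUnion]
  · simp_rw [hn]
    rw [ENNReal.tsum_mul_left, hsum, mul_one]
  · intro i j hij
    exact Set.disjoint_left.2 fun ω h1 h2 => hij (h1.1.symm.trans h2.1)
  · exact fun n => (hm τ (measurableSet_singleton n)).inter (hm τ' (measurableSet_singleton n))

lemma measure_arrow_pair (z : EvenSite) (n m : ℕ) (b b' : Bool) :
    P {ω | W.arrow z n ω = b ∧ W.arrow z m ω = b'} =
      if n = m then (if b = b' then 1 / 2 else 0) else 1 / 2 * (1 / 2) := by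
  split_ifs with h1 h2
  · subst h1 h2; simpa using W.arrow_law z n b
  · subst h1
    convert measure_empty (μ := P)
    ext ω
    simp only [Set.mem_ofPred_eq, Set.mem_empty_iff_false, iff_false, not_and]
    rintro rfl h
    exact h2 h
  · have hi := W.indep_arrow.indepFun (i := (z, n)) (j := (z, m)) (by simpa using h1)
    have := hi.measure_inter_preimage_eq_mul {b} {b'} (measurableSet_singleton _)
      (measurableSet_singleton _)
    exact this.trans (congrArg₂ _ (W.arrow_law z n b) (W.arrow_law z m b'))

end DynamicalDiscreteWeb

/-! ### Joint law of the arrows at two dynamical times -/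

lemma measure_mem_fiber_eq_mul {Ω ι : Type*} [MeasurableSpace Ω] {P : Measure Ω} [Countable ι]
    [MeasurableSpace ι] [MeasurableSingletonClass ι] {M : Ω → ι} (hM : Measurable M)
    {E : ι → Set Ω} (hE : ∀ i, MeasurableSet (E i)) (I : Set ι) {κ : ENNReal}
    (h : ∀ i ∈ I, P (M ⁻¹' {i} ∩ E i) = P (M ⁻¹' {i}) * κ) :
    P {ω | M ω ∈ I ∧ ω ∈ E (M ω)} = P (M ⁻¹' I) * κ := by
  have h1 : {ω | M ω ∈ I ∧ ω ∈ E (M ω)} = ⋃ i ∈ I, (M ⁻¹' {i} ∩ E i) := by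
    ext ω; simp
  have h2 : M ⁻¹' I = ⋃ i ∈ I, M ⁻¹' {i} := by
    ext ω; simp
  have hd : Set.univ.PairwiseDisjoint fun i => M ⁻¹' {i} := fun i _ j _ hij =>
    Set.disjoint_left.2 fun ω (h1 : _ = i) (h2 : _ = j) => hij (h1.symm.trans h2)
  rw [h1, h2, measure_biUnion I.to_countable, measure_biUnion I.to_countable,
    ← ENNReal.tsum_mul_right]
  · exact tsum_congr fun i => h i i.2
  · exact hd.subset (Set.subset_univ _)
  · exact fun i _ => hM (measurableSet_singleton i)
  · exact (hd.subset (Set.subset_univ _)).mono fun i => Set.inter_subset_left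
  · exact fun i _ => (hM (measurableSet_singleton i)).inter (hE i)

namespace DynamicalDiscreteWeb

variable {Ω : Type*} [mΩ : MeasurableSpace Ω] {P : Measure Ω} (W : DynamicalDiscreteWeb P)

/-- Ring counts depend on waits only, hence are independent of the arrow variables. Given the
counts, equal ones read the same variable and distinct ones read two independent fair variables. -/
lemma measure_arrowAt_pair (z : EvenSite) (τ τ' : ℝ) (b b' : Bool) :
    P {ω | W.arrowAt τ ω z = b ∧ W.arrowAt τ' ω z = b'} =
      P {ω | W.ringCount z τ ω = W.ringCount z τ' ω} * (if b = b' then 1 / 2 else 0) +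
      P {ω | W.ringCount z τ ω ≠ W.ringCount z τ' ω} * (1 / 2 * (1 / 2)) := by
  set M : Ω → ℕ × ℕ := fun ω => (W.ringCount z τ ω, W.ringCount z τ' ω) with hMdef
  set E : ℕ × ℕ → Set Ω := fun i => {ω | W.arrow z i.1 ω = b ∧ W.arrow z i.2 ω = b'} with hEdef
  set JW : Set ((EvenSite × ℕ) ⊕ (EvenSite × ℕ)) := Set.range Sum.inl
  set JA : Set ((EvenSite × ℕ) ⊕ (EvenSite × ℕ)) := Set.range Sum.inr
  have hJ : Disjoint JW JA := by
    rw [Set.disjoint_left]; rintro _ ⟨i, rfl⟩ ⟨j, hj⟩; cases hj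
  have hMW : Measurable[W.sigmaOf JW] M := by
    have hw : ∀ n, Measurable[W.sigmaOf JW] (W.wait z n) := fun n =>
      W.measurable_sigmaOf_wait ⟨_, rfl⟩
    exact (W.measurable_ringCount_of_time hw τ).prodMk (W.measurable_ringCount_of_time hw τ')
  have hEA : ∀ i, MeasurableSet[W.sigmaOf JA] (E i) := fun i =>
    MeasurableSet.inter
      (W.measurable_sigmaOf_arrow (J := JA) ⟨(z, i.1), rfl⟩ (measurableSet_singleton b))
      (W.measurable_sigmaOf_arrow (J := JA) ⟨(z, i.2), rfl⟩ (measurableSet_singleton b'))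
  have hM : Measurable M := hMW.mono (W.sigmaOf_le _) le_rfl
  have hE : ∀ i, MeasurableSet (E i) := fun i => W.sigmaOf_le _ _ (hEA i)
  have hprod : ∀ i, P (M ⁻¹' {i} ∩ E i) = P (M ⁻¹' {i}) * P (E i) := fun i =>
    (Indep_iff _ _ _).1 (W.indep_sigmaOf hJ) _ _ (hMW (measurableSet_singleton i)) (hEA i)
  have hdiag := measure_mem_fiber_eq_mul (P := P) hM hE {i | i.1 = i.2}
    (κ := if b = b' then 1 / 2 else 0) fun i hi => by
      rw [hprod, hEdef, W.measure_arrow_pair, if_pos (show i.1 = i.2 from hi)]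
  have hoff := measure_mem_fiber_eq_mul (P := P) hM hE {i | i.1 ≠ i.2}
    (κ := 1 / 2 * (1 / 2)) fun i hi => by
      rw [hprod, hEdef, W.measure_arrow_pair, if_neg (show ¬ i.1 = i.2 from hi)]
  have hsplit : {ω | W.arrowAt τ ω z = b ∧ W.arrowAt τ' ω z = b'} =
      {ω | M ω ∈ {i : ℕ × ℕ | i.1 = i.2} ∧ ω ∈ E (M ω)} ∪
      {ω | M ω ∈ {i : ℕ × ℕ | i.1 ≠ i.2} ∧ ω ∈ E (M ω)} := by
    ext ω
    simp only [arrowAt, hMdef, hEdef, Set.mem_ofPred_eq, Set.mem_union]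
    tauto
  rw [hsplit, measure_union, hdiag, hoff]
  · rfl
  · exact Set.disjoint_left.2 fun ω h1 h2 => h2.1 h1.1
  · have : {ω | M ω ∈ {i : ℕ × ℕ | i.1 ≠ i.2} ∧ ω ∈ E (M ω)} =
        ⋃ i ∈ {i : ℕ × ℕ | i.1 ≠ i.2}, (M ⁻¹' {i} ∩ E i) := by
      ext ω; simp
    rw [this]
    exact MeasurableSet.biUnion (Set.to_countable _) fun i _ =>
      (hM (measurableSet_singleton i)).inter (hE i)

/-- The correlation of the webs at the dynamical times `τ` and `τ'`. -/
def IsCorrelation (τ τ' ρ : ℝ) : Prop :=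
  ∀ z, P.real {ω | W.ringCount z τ ω = W.ringCount z τ' ω} = ρ

lemma real_arrowAt_pair [IsProbabilityMeasure P] {τ τ' ρ : ℝ} (h : W.IsCorrelation τ τ' ρ)
    (z : EvenSite) (b b' : Bool) :
    P.real {ω | W.arrowAt τ ω z = b ∧ W.arrowAt τ' ω z = b'} =
      if b = b' then (1 + ρ) / 4 else (1 - ρ) / 4 := by
  have hm : MeasurableSet {ω | W.ringCount z τ ω = W.ringCount z τ' ω} :=
    measurableSet_eq_fun (W.measurable_ringCount_of_time (W.measurable_wait z) τ)
      (W.measurable_ringCount_of_time (W.measurable_wait z) τ')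
  have hc : P.real {ω | W.ringCount z τ ω ≠ W.ringCount z τ' ω} = 1 - ρ := by
    rw [← h z, ← probReal_compl_eq_one_sub hm]; rfl
  have := congrArg ENNReal.toReal (W.measure_arrowAt_pair z τ τ' b b')
  rw [ENNReal.toReal_add (ENNReal.mul_ne_top (measure_ne_top _ _) (by split_ifs <;> simp))
    (ENNReal.mul_ne_top (measure_ne_top _ _) (ENNReal.mul_ne_top (by simp) (by simp))),
    ENNReal.toReal_mul, ENNReal.toReal_mul] at this
  change P.real _ = P.real _ * _ + P.real _ * _ at this
  rw [this, hc, h z]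
  split_ifs <;> simp <;> ring

lemma isCorrelation_self [IsProbabilityMeasure P] (τ : ℝ) : W.IsCorrelation τ τ 1 := by
  intro z; simp

lemma isCorrelation_exp [IsProbabilityMeasure P] {τ τ' : ℝ} (h0 : 0 ≤ τ) (h0' : 0 ≤ τ') :
    W.IsCorrelation τ τ' (Real.exp (-|τ - τ'|)) := by
  intro z
  rcases le_total τ τ' with h | h
  · rw [measureReal_def, W.measure_ringCount_eq z h0 h, ENNReal.toReal_ofReal (Real.exp_pos _).le,
      abs_of_nonpos (by linarith)]
    congr 1; ring
  · simp_rw [eq_comm (a := W.ringCount z τ _)]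
    rw [measureReal_def, W.measure_ringCount_eq z h0' h, ENNReal.toReal_ofReal (Real.exp_pos _).le,
      abs_of_nonneg (by linarith)]

lemma real_arrowAt_pair_of_ne [IsProbabilityMeasure P] {z z' : EvenSite} (hz : z ≠ z') (τ τ' : ℝ)
    (b b' : Bool) :
    P.real {ω | W.arrowAt τ ω z = b ∧ W.arrowAt τ' ω z' = b'} = 1 / 4 := by
  have hS : Disjoint ({z} : Set EvenSite) {z'} := Set.disjoint_singleton.2 hz
  have hmeas : ∀ (x : EvenSite) (τ : ℝ) (b : Bool),
      MeasurableSet[W.siteSigma {x}] {ω | W.arrowAt τ ω x = b} := by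
    intro x τ b
    have := W.measurable_arrowAt (m := W.siteSigma {x}) (z := x)
      (fun n => W.measurable_sigmaOf_wait rfl) (fun n => W.measurable_sigmaOf_arrow rfl)
    exact (this.comp measurable_prodMk_left) (measurableSet_singleton b)
  have hhalf : ∀ (x : EvenSite) (τ : ℝ) (b : Bool), P.real {ω | W.arrowAt τ ω x = b} = 1 / 2 := by
    intro x τ b
    have := W.real_arrowAt_pair (W.isCorrelation_self τ) x b b
    simp only [and_self, if_true] at this
    rw [this]; norm_num
  have := (Indep_iff _ _ _).1 (W.indep_siteSigma hS) _ _ (hmeas z τ b) (hmeas z' τ' b')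
  have e := congrArg ENNReal.toReal this
  rw [ENNReal.toReal_mul] at e
  change P.real _ = P.real _ * P.real _ at e
  rw [hhalf, hhalf] at e
  norm_num at e ⊢
  exact e

end DynamicalDiscreteWeb

/-! ### Paths above a barrier -/

/-- The endpoint of the arrow with direction `b` at `z`. -/
def EvenSite.step (z : EvenSite) (b : Bool) : EvenSite :=
  ⟨(z.1.1 + increment b, z.1.2 + 1), by
    have h := z.2
    cases b <;> simp only [increment] <;> grind⟩

lemma followArrow_eq_step (ξ : EvenSite → Bool) (z : EvenSite) :
    followArrow ξ z = z.step (ξ z) := rfl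

lemma webPath_succ (ξ : EvenSite → Bool) (z : EvenSite) (n : ℕ) :
    webPath ξ z (n + 1) = webPath ξ (z.step (ξ z)) n := by
  rw [webPath, Function.iterate_succ_apply, followArrow_eq_step]; rfl

/-- The path from `z` is at or to the right of `b` during its first `s` steps. -/
def Stays (ξ : EvenSite → Bool) (b : ℤ) (z : EvenSite) (s : ℕ) : Prop :=
  ∀ n ≤ s, b ≤ webPath ξ z n

lemma stays_zero {ξ : EvenSite → Bool} {b : ℤ} {z : EvenSite} : Stays ξ b z 0 ↔ b ≤ z.1.1 := by
  simp [Stays, webPath]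

lemma stays_succ {ξ : EvenSite → Bool} {b : ℤ} {z : EvenSite} {s : ℕ} :
    Stays ξ b z (s + 1) ↔ b ≤ z.1.1 ∧ Stays ξ b (z.step (ξ z)) s := by
  constructor
  · intro h
    refine ⟨h 0 (by omega), fun n hn => ?_⟩
    rw [← webPath_succ]
    exact h (n + 1) (by omega)
  · rintro ⟨h0, h⟩ n hn
    rcases n with _ | n
    · exact h0
    · rw [webPath_succ]; exact h n (by omega)

/-- The sites with time coordinate in `[i, j)`. -/
def levelSet (i j : ℤ) : Set EvenSite := {z | i ≤ z.1.2 ∧ z.1.2 < j}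

lemma measurableSet_of_time {Ω : Type*} {m : MeasurableSpace Ω} {D : Set (ℝ × Ω)}
    (hD : MeasurableSet[(inferInstance : MeasurableSpace ℝ).prod m] D) (τ : ℝ) :
    MeasurableSet[m] {ω | (τ, ω) ∈ D} := by
  have h1 : Measurable[m, (inferInstance : MeasurableSpace ℝ).prod m] (Prod.mk τ : Ω → ℝ × Ω) :=
    measurable_prodMk_left
  exact h1 hD

namespace DynamicalDiscreteWeb

variable {Ω : Type*} [mΩ : MeasurableSpace Ω] {P : Measure Ω} (W : DynamicalDiscreteWeb P)

lemma measurable_siteSigma_arrowAt {S : Set EvenSite} {z : EvenSite} (hz : z ∈ S) :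
    Measurable[(inferInstance : MeasurableSpace ℝ).prod (W.siteSigma S)]
      (fun p : ℝ × Ω => W.arrowAt p.1 p.2 z) :=
  W.measurable_arrowAt (fun _ => W.measurable_sigmaOf_wait hz)
    (fun _ => W.measurable_sigmaOf_arrow hz)

lemma measurableSet_stays {S : Set EvenSite} (b : ℤ) (z : EvenSite) (s : ℕ)
    (hS : levelSet z.1.2 (z.1.2 + s) ⊆ S) :
    MeasurableSet[(inferInstance : MeasurableSpace ℝ).prod (W.siteSigma S)]
      {p : ℝ × Ω | Stays (W.arrowAt p.1 p.2) b z s} := by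
  induction s generalizing z with
  | zero => simp only [stays_zero]; exact MeasurableSet.const _
  | succ s ih =>
    have hz : z ∈ S := hS ⟨le_rfl, by push_cast; omega⟩
    have e : {p : ℝ × Ω | Stays (W.arrowAt p.1 p.2) b z (s + 1)} =
        {_p : ℝ × Ω | b ≤ z.1.1} ∩ ⋃ c : Bool, ((fun p : ℝ × Ω => W.arrowAt p.1 p.2 z) ⁻¹' {c} ∩
          {p : ℝ × Ω | Stays (W.arrowAt p.1 p.2) b (z.step c) s}) := by
      ext p
      simp [stays_succ]
    rw [e]
    refine (MeasurableSet.const _).inter (MeasurableSet.iUnion fun c => ?_)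
    refine MeasurableSet.inter (W.measurable_siteSigma_arrowAt hz (measurableSet_singleton c))
      (ih (z.step c) ?_)
    intro x hx
    refine hS ⟨?_, ?_⟩
    · have : z.1.2 + 1 ≤ x.1.2 := hx.1
      omega
    · have : x.1.2 < z.1.2 + 1 + s := hx.2
      push_cast; omega

lemma measurableSet_stays_of_time {S : Set EvenSite} (τ : ℝ) (b : ℤ) (z : EvenSite) (s : ℕ)
    (hS : levelSet z.1.2 (z.1.2 + s) ⊆ S) :
    MeasurableSet[W.siteSigma S] {ω | Stays (W.arrowAt τ ω) b z s} :=
  measurableSet_of_time (W.measurableSet_stays b z s hS) τ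

lemma real_inter_of_disjoint {S T : Set EvenSite} (h : Disjoint S T) {A B : Set Ω}
    (hA : MeasurableSet[W.siteSigma S] A) (hB : MeasurableSet[W.siteSigma T] B) :
    P.real (A ∩ B) = P.real A * P.real B := by
  rw [measureReal_def, (Indep_iff _ _ _).1 (W.indep_siteSigma h) A B hA hB, ENNReal.toReal_mul]
  rfl

/-- The probability that the paths of two webs stay above the barrier `b`. -/
lemma real_stays_pair [IsProbabilityMeasure P] {τ τ' ρ : ℝ} (hρ : W.IsCorrelation τ τ' ρ) (b : ℤ)
    (s : ℕ) (z z' : EvenSite) (hz : z.1.2 = z'.1.2) :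
    P.real {ω | Stays (W.arrowAt τ ω) b z s ∧ Stays (W.arrowAt τ' ω) b z' s} =
      pairStayProb ρ s (z.1.1 - b) (z'.1.1 - b) := by
  induction s generalizing z z' with
  | zero =>
    simp only [stays_zero, pairStayProb, sub_nonneg]
    split_ifs with h <;> simp [h]
  | succ s ih =>
    by_cases hb : b ≤ z.1.1 ∧ b ≤ z'.1.1
    swap
    · have : {ω | Stays (W.arrowAt τ ω) b z (s + 1) ∧ Stays (W.arrowAt τ' ω) b z' (s + 1)} = ∅ := by
        ext ω
        simp only [stays_succ, Set.mem_ofPred_eq, Set.mem_empty_iff_false, iff_false]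
        tauto
      rw [this, pairStayProb, if_neg (by simpa using hb)]
      simp
    set f : Ω → Bool × Bool := fun ω => (W.arrowAt τ ω z, W.arrowAt τ' ω z') with hf
    set E := {ω | Stays (W.arrowAt τ ω) b z (s + 1) ∧ Stays (W.arrowAt τ' ω) b z' (s + 1)} with hE
    -- Markov property: the current arrows live on one level and the rest of both paths on later
    -- levels, so they are independent.
    have hfm : Measurable[W.siteSigma (levelSet z.1.2 (z.1.2 + 1))] f := by
      have h1 := W.measurable_siteSigma_arrowAt (S := levelSet z.1.2 (z.1.2 + 1)) (z := z)
        ⟨le_rfl, by omega⟩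
      have h2 := W.measurable_siteSigma_arrowAt (S := levelSet z.1.2 (z.1.2 + 1)) (z := z')
        ⟨hz.le, by omega⟩
      exact Measurable.prodMk (fun s hs => measurableSet_of_time (h1 hs) τ)
        (fun s hs => measurableSet_of_time (h2 hs) τ')
    have hfm' : Measurable f := hfm.mono (W.siteSigma_le _) le_rfl
    have hterm : ∀ c c', P.real (E ∩ f ⁻¹' {(c, c')}) = P.real (f ⁻¹' {(c, c')}) *
        pairStayProb ρ s (z.1.1 - b + increment c) (z'.1.1 - b + increment c') := by
      intro c c'
      have he : E ∩ f ⁻¹' {(c, c')} = f ⁻¹' {(c, c')} ∩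
          {ω | Stays (W.arrowAt τ ω) b (z.step c) s ∧ Stays (W.arrowAt τ' ω) b (z'.step c') s} := by
        ext ω
        simp only [hE, hf, stays_succ, Set.mem_inter_iff, Set.mem_ofPred_eq, Set.mem_preimage,
          Set.mem_singleton_iff, Prod.mk.injEq]
        constructor
        · rintro ⟨⟨⟨-, h1⟩, -, h2⟩, rfl, rfl⟩
          exact ⟨⟨rfl, rfl⟩, h1, h2⟩
        · rintro ⟨⟨rfl, rfl⟩, h1, h2⟩
          exact ⟨⟨⟨hb.1, h1⟩, hb.2, h2⟩, rfl, rfl⟩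
      have hd : Disjoint (levelSet z.1.2 (z.1.2 + 1)) (levelSet (z.1.2 + 1) (z.1.2 + 1 + s)) :=
        Set.disjoint_left.2 fun x hx hx' => not_lt.2 hx'.1 hx.2
      rw [he, W.real_inter_of_disjoint hd (hfm (measurableSet_singleton _)),
        ih (z.step c) (z'.step c') (by simp [EvenSite.step, hz])]
      · congr 2 <;> simp only [EvenSite.step] <;> ring
      · refine MeasurableSet.inter (W.measurableSet_stays_of_time _ _ _ _ le_rfl)
          (W.measurableSet_stays_of_time _ _ _ _ ?_)
        simp only [EvenSite.step, hz]
        exact le_rfl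
    have hsum : P.real E = ∑ c : Bool × Bool, P.real (E ∩ f ⁻¹' {c}) := by
      have := sum_measureReal_preimage_singleton (μ := P.restrict E) (f := f) Finset.univ
        (fun y _ => hfm' (measurableSet_singleton y))
      simp only [Finset.coe_univ, Set.preimage_univ] at this
      rw [measureReal_restrict_apply_univ] at this
      rw [← this]
      refine Finset.sum_congr rfl fun c _ => ?_
      rw [measureReal_restrict_apply (hfm' (measurableSet_singleton c)), Set.inter_comm]
    rw [hsum, Fintype.sum_prod_type]
    simp only [Fintype.sum_bool, hterm]
    rw [pairStayProb, if_pos (by simpa using hb)]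
    -- Only a common site correlates the two webs; distinct sites are independent even at different
    -- dynamical times.
    by_cases hzz : z = z'
    · subst hzz
      have hp : ∀ c c', P.real (f ⁻¹' {(c, c')}) =
          if c = c' then (1 + ρ) / 4 else (1 - ρ) / 4 := by
        intro c c'
        rw [← W.real_arrowAt_pair hρ z c c']
        congr 1
        ext ω
        simp [hf]
      simp only [hp, increment]
      simp only [if_true, Bool.false_eq_true, Bool.true_eq_false, if_false, ← sub_eq_add_neg]
      ring
    · have hp : ∀ c c', P.real (f ⁻¹' {(c, c')}) = 1 / 4 := by
        intro c c'
        rw [← W.real_arrowAt_pair_of_ne hzz τ τ' c c']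
        congr 1
        ext ω
        simp [hf]
      have hne : ¬ (z.1.1 - b = z'.1.1 - b) := fun h =>
        hzz (Subtype.ext (Prod.ext (by omega) hz))
      rw [if_neg hne]
      simp only [hp, increment]
      simp only [if_true, Bool.false_eq_true, if_false, ← sub_eq_add_neg]
      ring

end DynamicalDiscreteWeb

/-! ### Scales -/

/-- The time `∑_{j < k} 4 ^ (j + 1)` at which scale `k` starts. -/
def startTime (k : ℕ) : ℕ := ∑ j ∈ Finset.range k, 4 ^ (j + 1)

/-- The depth `∑_{j < k} 4 · 2 ^ (j + 1)` at which scale `k` starts. -/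
def startDepth (k : ℕ) : ℕ := ∑ j ∈ Finset.range k, scaleDepth j

lemma startTime_succ (k : ℕ) : startTime (k + 1) = startTime k + 4 ^ (k + 1) :=
  Finset.sum_range_succ _ _

lemma startDepth_succ (k : ℕ) : startDepth (k + 1) = startDepth k + scaleDepth k :=
  Finset.sum_range_succ _ _

lemma startTime_mono : Monotone startTime :=
  monotone_nat_of_le_succ fun k => by rw [startTime_succ]; exact Nat.le_add_right _ _

/-- The site at which scale `k` starts. -/
def scaleStart (k : ℕ) : EvenSite :=
  ⟨(-(startDepth k : ℤ), (startTime k : ℤ)), by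
    have h1 : Even (startDepth k : ℤ) := by
      rw [Int.even_coe_nat]
      exact Finset.even_sum _ fun j _ => by
        rw [scaleDepth]; exact (by decide : Even 4).mul_right _
    have h2 : Even (startTime k : ℤ) := by
      rw [Int.even_coe_nat]
      exact Finset.even_sum _ fun j _ => (by decide : Even 4).pow_of_ne_zero (by omega)
    exact h1.neg.add h2⟩

/-- The path that starts with scale `k` does not reach, within that scale, the space left of the
start of the next scale. -/
def ScaleEvent (ξ : EvenSite → Bool) (k : ℕ) : Prop :=
  Stays ξ (-(startDepth (k + 1) : ℤ)) (scaleStart k) (4 ^ (k + 1))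

namespace DynamicalDiscreteWeb

variable {Ω : Type*} [mΩ : MeasurableSpace Ω] {P : Measure Ω} (W : DynamicalDiscreteWeb P)

lemma measurableSet_scaleEvent {S : Set EvenSite} (k : ℕ)
    (hS : levelSet (startTime k) (startTime (k + 1)) ⊆ S) :
    MeasurableSet[(inferInstance : MeasurableSpace ℝ).prod (W.siteSigma S)]
      {p : ℝ × Ω | ScaleEvent (W.arrowAt p.1 p.2) k} := by
  refine W.measurableSet_stays _ _ _ (subset_trans ?_ hS)
  rw [startTime_succ]
  push_cast
  exact le_rfl

lemma real_scaleEvent_pair [IsProbabilityMeasure P] {τ τ' ρ : ℝ} (hρ : W.IsCorrelation τ τ' ρ)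
    (k : ℕ) :
    P.real {ω | ScaleEvent (W.arrowAt τ ω) k ∧ ScaleEvent (W.arrowAt τ' ω) k} =
      pairStayProb ρ (4 ^ (k + 1)) (scaleDepth k) (scaleDepth k) := by
  have h := W.real_stays_pair hρ (-(startDepth (k + 1) : ℤ)) (4 ^ (k + 1)) (scaleStart k)
    (scaleStart k) rfl
  have e : (scaleStart k).1.1 - -(startDepth (k + 1) : ℤ) = scaleDepth k := by
    rw [startDepth_succ]; simp [scaleStart]
  rw [e] at h
  exact h

/-- The events of different scales are independent. -/
lemma real_forall_scaleEvent_pair [IsProbabilityMeasure P] {τ τ' ρ : ℝ}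
    (hρ : W.IsCorrelation τ τ' ρ) (k₀ n : ℕ) :
    P.real {ω | ∀ j < n, ScaleEvent (W.arrowAt τ ω) (k₀ + j) ∧
        ScaleEvent (W.arrowAt τ' ω) (k₀ + j)} =
      ∏ j ∈ Finset.range n,
        pairStayProb ρ (4 ^ (k₀ + j + 1)) (scaleDepth (k₀ + j)) (scaleDepth (k₀ + j)) := by
  induction n with
  | zero => simp
  | succ n ih =>
    have hE : ∀ k, MeasurableSet[W.siteSigma (levelSet (startTime k) (startTime (k + 1)))]
        {ω | ScaleEvent (W.arrowAt τ ω) k ∧ ScaleEvent (W.arrowAt τ' ω) k} := fun k =>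
      MeasurableSet.inter (measurableSet_of_time (W.measurableSet_scaleEvent k le_rfl) τ)
        (measurableSet_of_time (W.measurableSet_scaleEvent k le_rfl) τ')
    have hsplit : {ω | ∀ j < n + 1, ScaleEvent (W.arrowAt τ ω) (k₀ + j) ∧
        ScaleEvent (W.arrowAt τ' ω) (k₀ + j)} =
        {ω | ∀ j < n, ScaleEvent (W.arrowAt τ ω) (k₀ + j) ∧
          ScaleEvent (W.arrowAt τ' ω) (k₀ + j)} ∩
        {ω | ScaleEvent (W.arrowAt τ ω) (k₀ + n) ∧ ScaleEvent (W.arrowAt τ' ω) (k₀ + n)} := by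
      ext ω
      simp only [Set.mem_ofPred_eq, Set.mem_inter_iff, Nat.forall_lt_succ_right]
    have hd : Disjoint (levelSet 0 (startTime (k₀ + n)))
        (levelSet (startTime (k₀ + n)) (startTime (k₀ + n + 1))) :=
      Set.disjoint_left.2 fun x hx hx' => not_lt.2 hx'.1 hx.2
    rw [hsplit, W.real_inter_of_disjoint hd _ (hE _), ih, Finset.prod_range_succ,
      W.real_scaleEvent_pair hρ]
    have : {ω | ∀ j < n, ScaleEvent (W.arrowAt τ ω) (k₀ + j) ∧
        ScaleEvent (W.arrowAt τ' ω) (k₀ + j)} = ⋂ j ∈ Finset.range n,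
        {ω | ScaleEvent (W.arrowAt τ ω) (k₀ + j) ∧ ScaleEvent (W.arrowAt τ' ω) (k₀ + j)} := by
      ext ω; simp
    rw [this]
    refine Finset.measurableSet_biInter _ fun j hj => ?_
    refine W.siteSigma_mono ?_ _ (hE (k₀ + j))
    intro x hx
    refine ⟨(by positivity : (0 : ℤ) ≤ _).trans hx.1, hx.2.trans_le ?_⟩
    have := startTime_mono (show k₀ + j + 1 ≤ k₀ + n by simp at hj; omega)
    exact_mod_cast this

lemma real_forall_scaleEvent [IsProbabilityMeasure P] (τ : ℝ) (k₀ n : ℕ) :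
    P.real {ω | ∀ j < n, ScaleEvent (W.arrowAt τ ω) (k₀ + j)} =
      ∏ j ∈ Finset.range n, stayProb (4 ^ (k₀ + j + 1)) (scaleDepth (k₀ + j)) := by
  have := W.real_forall_scaleEvent_pair (W.isCorrelation_self τ) k₀ n
  simpa only [and_self, pairStayProb_one] using this

/-- At a fixed dynamical time, the events of all large scales do not occur simultaneously. -/
lemma measure_forall_scaleEvent_eq_zero [IsProbabilityMeasure P] (τ : ℝ) (k₀ : ℕ) :
    P {ω | ∀ k ≥ k₀, ScaleEvent (W.arrowAt τ ω) k} = 0 := by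
  obtain ⟨q, h0, h1, k₁, hq⟩ := exists_stayProb_scale_le
  have hle : ∀ n, P.real {ω | ∀ k ≥ k₀, ScaleEvent (W.arrowAt τ ω) k} ≤ q ^ n := by
    -- The bound `q` is available only from scale `k₁` on, hence the shift by `k₁`.
    intro n
    calc P.real {ω | ∀ k ≥ k₀, ScaleEvent (W.arrowAt τ ω) k}
        ≤ P.real {ω | ∀ j < n, ScaleEvent (W.arrowAt τ ω) (k₀ + k₁ + j)} :=
          measureReal_mono fun ω hω j _ => hω _ (by omega)
      _ ≤ ∏ j ∈ Finset.range n, q := by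
          rw [W.real_forall_scaleEvent]
          exact Finset.prod_le_prod (fun j _ => stayProb_nonneg _ _) fun j _ => hq _ (by omega)
      _ = q ^ n := by simp
  have := ge_of_tendsto' (tendsto_pow_atTop_nhds_zero_of_lt_one h0 h1) hle
  exact (measureReal_eq_zero_iff).1 (le_antisymm this measureReal_nonneg)

end DynamicalDiscreteWeb

/-! ### From the scale events to subdiffusivity -/

/-- Paths of a web do not cross. -/
lemma webPath_mono (ξ : EvenSite → Bool) {z z' : EvenSite} (ht : z.1.2 = z'.1.2)
    (hx : z.1.1 ≤ z'.1.1) (n : ℕ) : webPath ξ z n ≤ webPath ξ z' n := by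
  induction n generalizing z z' with
  | zero => exact hx
  | succ n ih =>
    rw [webPath_succ, webPath_succ]
    refine ih (by simp [EvenSite.step, ht]) ?_
    rcases eq_or_lt_of_le hx with h | h
    · rw [show z = z' from Subtype.ext (Prod.ext h ht)]
    -- By parity, distinct sites of one level differ by at least `2`, so unit steps cannot swap
    -- them.
    · have h1 := z.2
      have h2 := z'.2
      simp only [EvenSite.step, increment]
      split_ifs <;> grind

lemma iterate_followArrow_level (ξ : EvenSite → Bool) (z : EvenSite) (n : ℕ) :
    ((followArrow ξ)^[n] z).1.2 = z.1.2 + n := by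
  induction n with
  | zero => simp
  | succ n ih =>
    rw [Function.iterate_succ_apply']
    simp only [followArrow, ih]
    push_cast; ring

lemma webPath_add (ξ : EvenSite → Bool) (z : EvenSite) (n k : ℕ) :
    webPath ξ z (n + k) = webPath ξ ((followArrow ξ)^[n] z) k := by
  rw [webPath, add_comm, Function.iterate_add_apply]; rfl

/-- At the start of each scale the origin path is at or to the right of `scaleStart k`; non-crossing
carries this through the scale. -/
lemma neg_startDepth_le_webPath {ξ : EvenSite → Bool} (h : ∀ k, ScaleEvent ξ k) (k n : ℕ)
    (hn : n ≤ 4 ^ (k + 1)) :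
    -(startDepth (k + 1) : ℤ) ≤ webPath ξ EvenSite.origin (startTime k + n) := by
  have hscale : ∀ k, -(startDepth k : ℤ) ≤ webPath ξ EvenSite.origin (startTime k) →
      ∀ n ≤ 4 ^ (k + 1),
        -(startDepth (k + 1) : ℤ) ≤ webPath ξ EvenSite.origin (startTime k + n) := by
    intro k hk n hn
    rw [webPath_add]
    refine (h k n hn).trans (webPath_mono ξ ?_ hk n)
    rw [iterate_followArrow_level]
    simp [scaleStart, EvenSite.origin]
  have hstart : ∀ k, -(startDepth k : ℤ) ≤ webPath ξ EvenSite.origin (startTime k) := by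
    intro k
    induction k with
    | zero => simp [startDepth, startTime, webPath, EvenSite.origin]
    | succ k ih => rw [startTime_succ]; exact hscale k ih _ le_rfl
  exact hscale k (hstart k) n hn

lemma startDepth_add (k : ℕ) : startDepth k + 8 = 8 * 2 ^ k := by
  induction k with
  | zero => simp [startDepth]
  | succ k ih => rw [startDepth_succ, scaleDepth, pow_succ]; omega

lemma exists_scale (N : ℕ) : ∃ k n, n ≤ 4 ^ (k + 1) ∧ N = startTime k + n := by
  have hex : ∃ k, N < startTime (k + 1) := by
    refine ⟨N, ?_⟩
    have h1 : N + 1 < 4 ^ (N + 1) := Nat.lt_pow_self (by norm_num)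
    rw [startTime_succ]; omega
  classical
  have h1 := Nat.find_spec hex
  have h2 : startTime (Nat.find hex) ≤ N := by
    rcases h : Nat.find hex with _ | k
    · simp [startTime]
    · exact not_lt.1 (Nat.find_min hex (show k < Nat.find hex by omega))
  rw [startTime_succ] at h1
  exact ⟨Nat.find hex, N - startTime (Nat.find hex), by omega, by omega⟩

/-- By the end of scale `k` the barrier is at depth `16 * 2 ^ k - 8`, while for `k ≥ 1` scale `k`
starts after at least `4 ^ k` steps. -/
lemma webPath_lower_bound {ξ : EvenSite → Bool} (h : ∀ k, ScaleEvent ξ k) (N : ℕ) :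
    -16 - 16 * √N ≤ (webPath ξ EvenSite.origin N : ℝ) := by
  obtain ⟨k, n, hn, rfl⟩ := exists_scale N
  have h1 := neg_startDepth_le_webPath h k n hn
  have h2 : -(startDepth (k + 1) : ℝ) ≤ webPath ξ EvenSite.origin (startTime k + n) := by
    exact_mod_cast h1
  have h3 : (startDepth (k + 1) : ℝ) + 8 = 8 * 2 ^ (k + 1) := by
    exact_mod_cast startDepth_add (k + 1)
  have h4 : (2 : ℝ) ^ k ≤ 1 + √((startTime k + n : ℕ) : ℝ) := by
    rcases k with _ | k
    · simp
    · have : (2 : ℝ) ^ (k + 1) ≤ √((startTime (k + 1) + n : ℕ) : ℝ) := by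
        refine Real.le_sqrt_of_sq_le ?_
        have e : ((2 : ℝ) ^ (k + 1)) ^ 2 = (4 ^ (k + 1) : ℕ) := by
          rw [← pow_mul, mul_comm, pow_mul]; norm_num
        rw [e, Nat.cast_le, startTime_succ]
        omega
      linarith
  rw [pow_succ] at h3
  linarith

lemma isPlusSubdiffusive_of_scaleEvent {ξ : EvenSite → Bool} (h : ∀ k, ScaleEvent ξ k) {K : ℝ}
    (hK : 16 ≤ K) :
    IsPlusSubdiffusive K (linearInterpolation (webPath ξ EvenSite.origin)) := by
  -- `16` from integer times, and `1` for the step being interpolated.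
  refine ⟨17, by norm_num, fun t ht => ?_⟩
  set N := ⌊t⌋₊ with hN
  have hNt : (N : ℝ) ≤ t := Nat.floor_le ht.le
  have hNt' : t < N + 1 := Nat.lt_floor_add_one t
  have hb := webPath_lower_bound h N
  have hstep : -1 ≤ (webPath ξ EvenSite.origin (N + 1) : ℝ) - webPath ξ EvenSite.origin N := by
    have : -1 ≤ webPath ξ EvenSite.origin (N + 1) - webPath ξ EvenSite.origin N := by
      rw [webPath, Function.iterate_succ_apply', followArrow]
      simp only [webPath, increment]
      split_ifs <;> omega
    exact_mod_cast this
  have hsq : √(N : ℝ) ≤ √t := Real.sqrt_le_sqrt hNt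
  have hsq0 := Real.sqrt_nonneg t
  have hprod : (16 : ℝ) * √t ≤ K * √t := by gcongr
  simp only [linearInterpolation, ← hN]
  nlinarith

/-! ### Exceptional times -/

namespace DynamicalDiscreteWeb

variable {Ω : Type*} [mΩ : MeasurableSpace Ω] {P : Measure Ω} {W : DynamicalDiscreteWeb P}

/-- Only finitely many rings precede `τ₀ + 1`, and each stays on its side of `τ₀` under small
perturbation. -/
lemma GoodClock.eventually_arrowAt_eq {z : EvenSite} {ω : Ω} (h : W.GoodClock z ω) {τ₀ : ℝ}
    (hτ : ∀ n, W.ringTime z n ω ≠ τ₀) :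
    ∀ᶠ τ in nhds τ₀, W.arrowAt τ ω z = W.arrowAt τ₀ ω z := by
  have hfin := h.finite (τ₀ + 1)
  have h1 : ∀ᶠ τ in nhds τ₀, ∀ n ∈ {n : ℕ | W.ringTime z n ω ≤ τ₀ + 1},
      (W.ringTime z n ω ≤ τ ↔ W.ringTime z n ω ≤ τ₀) := by
    rw [Filter.eventually_all_finite hfin]
    intro n _
    rcases lt_or_gt_of_ne (hτ n) with hn | hn
    · filter_upwards [lt_mem_nhds hn] with τ hτ
      exact ⟨fun _ => hn.le, fun _ => le_of_lt hτ⟩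
    · filter_upwards [gt_mem_nhds hn] with τ hτ
      exact ⟨fun h => absurd h (not_le.2 hτ), fun h => absurd h (not_le.2 hn)⟩
  filter_upwards [h1, gt_mem_nhds (show τ₀ < τ₀ + 1 by linarith)] with τ h1 h2
  have : {n : ℕ | W.ringTime z n ω ≤ τ} = {n : ℕ | W.ringTime z n ω ≤ τ₀} := by
    ext n
    by_cases hn : W.ringTime z n ω ≤ τ₀ + 1
    · exact h1 n hn
    · simp only [Set.mem_ofPred_eq]
      constructor <;> intro h <;> exact absurd (by linarith) hn
  rw [arrowAt, arrowAt, ringCount, ringCount, this]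

/-- Follow the path at time `τ₀`: it reads finitely many arrows. The level `a` allows a ringing site
below it to be ignored. -/
lemma eventually_stays_iff {ω : Ω} {τ₀ : ℝ} {a : ℤ}
    (h : ∀ z : EvenSite, a ≤ z.1.2 → ∀ᶠ τ in nhds τ₀, W.arrowAt τ ω z = W.arrowAt τ₀ ω z)
    (b : ℤ) (s : ℕ) (z : EvenSite) (hz : a ≤ z.1.2) :
    ∀ᶠ τ in nhds τ₀, (Stays (W.arrowAt τ ω) b z s ↔ Stays (W.arrowAt τ₀ ω) b z s) := by
  induction s generalizing z with
  | zero => simp [stays_zero]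
  | succ s ih =>
    filter_upwards [h z hz, ih (z.step (W.arrowAt τ₀ ω z))
      (by simp only [EvenSite.step]; omega)] with τ h1 h2
    rw [stays_succ, stays_succ, h1, h2]

variable (W)

/-- The almost sure properties of the ring times: clocks do not ring simultaneously, and at a ring
time the events of all large scales do not occur simultaneously. -/
def GoodRings (ω : Ω) : Prop :=
  ∀ z n, (∀ z' ≠ z, ∀ n', W.ringTime z' n' ω ≠ W.ringTime z n ω) ∧
    ∀ k₀, z.1.2 < startTime k₀ → ∃ k ≥ k₀, ¬ ScaleEvent (W.arrowAt (W.ringTime z n ω) ω) k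

variable {W}

/-- Compactness of `[0, 1]`; the good times need not form a closed set, since arrows jump at ring
times. -/
lemma exists_forall_scaleEvent {ω : Ω} (hclock : ∀ z, W.GoodClock z ω) (hring : W.GoodRings ω)
    (h : ∀ n, ∃ τ ∈ Set.Icc (0 : ℝ) 1, ∀ k < n, ScaleEvent (W.arrowAt τ ω) k) :
    ∃ τ ∈ Set.Icc (0 : ℝ) 1, ∀ k, ScaleEvent (W.arrowAt τ ω) k := by
  choose τ hτ hE using h
  obtain ⟨τ₀, hτ₀, φ, hφ, hlim⟩ := isCompact_Icc.tendsto_subseq hτ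
  have key : ∀ a : ℤ, (∀ z : EvenSite, a ≤ z.1.2 → ∀ n, W.ringTime z n ω ≠ τ₀) →
      ∀ k, a ≤ startTime k → ScaleEvent (W.arrowAt τ₀ ω) k := by
    intro a ha k hk
    have h1 := eventually_stays_iff (W := W) (ω := ω) (τ₀ := τ₀) (a := a)
      (fun z hz => (hclock z).eventually_arrowAt_eq (ha z hz)) (-(startDepth (k + 1) : ℤ))
      (4 ^ (k + 1)) (scaleStart k) hk
    obtain ⟨n, hn1, hn2⟩ := ((hlim.eventually h1).and (Filter.eventually_gt_atTop k)).exists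
    exact hn1.1 (hE (φ n) k (hn2.trans_le hφ.le_apply))
  -- If `z` rings at `τ₀`, no other site does, so the scale events above the level of `z` pass to
  -- the limit, against `GoodRings`.
  by_cases hr : ∃ z n, W.ringTime z n ω = τ₀
  · exfalso
    obtain ⟨z, n, hzn⟩ := hr
    obtain ⟨h1, h2⟩ := hring z n
    rw [hzn] at h1 h2
    obtain ⟨k₀, hk₀⟩ : ∃ k₀, z.1.2 < startTime k₀ := by
      refine ⟨z.1.2.toNat + 1, ?_⟩
      have : z.1.2.toNat + 1 < 4 ^ (z.1.2.toNat + 1) := Nat.lt_pow_self (by norm_num)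
      rw [startTime_succ]
      have e : z.1.2 ≤ z.1.2.toNat := Int.self_le_toNat _
      push_cast
      have : ((z.1.2.toNat : ℤ)) + 1 < 4 ^ (z.1.2.toNat + 1) := by exact_mod_cast this
      omega
    obtain ⟨k, hk, hk'⟩ := h2 k₀ hk₀
    refine hk' (key (startTime k₀) (fun z' hz' => h1 z' ?_) k (by exact_mod_cast startTime_mono hk))
    rintro rfl
    omega
  · push Not at hr
    exact ⟨τ₀, hτ₀, fun k => key 0 (fun z _ => hr z) k (by positivity)⟩

variable (W)

lemma measure_ringTime_eq [IsProbabilityMeasure P] (z : EvenSite) (n : ℕ) (t : ℝ) :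
    P {ω | W.ringTime z n ω = t} = 0 := by
  have := (W.indepFun_clock_wait z n).measure_prod_eq_zero (W.measurable_clock z n)
    (W.measurable_wait z n) (D := {p | p.1 + p.2 = t})
    (measurableSet_eq_fun (measurable_fst.add measurable_snd) measurable_const) fun s => by
      have h := W.measure_wait_preimage z n (measurableSet_singleton (t - s))
      rw [expMeasure_one_singleton] at h
      rw [← h]
      congr 1
      ext ω
      simp [eq_sub_iff_add_eq']
  simp_rw [ringTime_eq_clock, clock_succ]
  exact this

/-- A ring time of `z` is independent of the other sites, and both properties concern other sites
only and fail with probability zero at a fixed time. -/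
lemma ae_goodRings [IsProbabilityMeasure P] : ∀ᵐ ω ∂P, W.GoodRings ω := by
  unfold GoodRings
  rw [ae_all_iff]; intro z
  rw [ae_all_iff]; intro n
  have hind := W.indep_siteSigma (S := {z}) (T := {z}ᶜ) disjoint_compl_right
  have hT : ∀ (S : Set EvenSite) (x : EvenSite), x ∈ S → ∀ n,
      Measurable[W.siteSigma S] (W.ringTime x n) := fun S x hx n =>
    Finset.measurable_fun_sum _ fun i _ => W.measurable_sigmaOf_wait hx
  have hTz := hT {z} z rfl n
  refine Filter.Eventually.and ?_ ?_
  · rw [ae_all_iff]; intro z'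
    by_cases hz : z' = z
    · simp [hz]
    simp only [ne_eq, hz, not_false_eq_true, forall_true_left]
    rw [ae_all_iff]; intro n'
    rw [ae_iff]
    simp only [not_not]
    refine measure_graph_eq_zero (D := {p : ℝ × Ω | W.ringTime z' n' p.2 = p.1})
      (W.siteSigma_le _) (W.siteSigma_le _) hind hTz ?_ (W.measure_ringTime_eq z' n')
    have h2 : Measurable[(inferInstance : MeasurableSpace ℝ).prod (W.siteSigma {z}ᶜ)]
        (fun p : ℝ × Ω => W.ringTime z' n' p.2) := (hT {z}ᶜ z' hz n').comp measurable_snd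
    exact measurableSet_eq_fun h2 measurable_fst
  · rw [ae_all_iff]; intro k₀
    by_cases hk : z.1.2 < startTime k₀
    swap
    · simp [hk]
    simp only [hk, forall_true_left]
    rw [ae_iff]
    push Not
    refine measure_graph_eq_zero
      (D := {p : ℝ × Ω | ∀ k ≥ k₀, ScaleEvent (W.arrowAt p.1 p.2) k})
      (W.siteSigma_le _) (W.siteSigma_le _) hind hTz ?_
      (fun t => W.measure_forall_scaleEvent_eq_zero t k₀)
    have e : {p : ℝ × Ω | ∀ k ≥ k₀, ScaleEvent (W.arrowAt p.1 p.2) k} =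
        ⋂ k ∈ {k | k₀ ≤ k}, {p : ℝ × Ω | ScaleEvent (W.arrowAt p.1 p.2) k} := by
      ext p; simp
    rw [e]
    refine MeasurableSet.biInter (Set.to_countable _) fun k hk' =>
      W.measurableSet_scaleEvent k fun x hx hxz => ?_
    rw [Set.mem_singleton_iff] at hxz
    subst hxz
    have : (startTime k₀ : ℤ) ≤ startTime k := by exact_mod_cast startTime_mono hk'
    have := hx.1
    omega

end DynamicalDiscreteWeb

/-! ### The second moment -/

/-- The second moment method for a nonnegative function. -/
lemma sq_lintegral_le_measure_ne_zero_mul {Ω : Type*} [MeasurableSpace Ω] {P : Measure Ω}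
    {f : Ω → ENNReal} (hf : Measurable f) :
    (∫⁻ ω, f ω ∂P) ^ 2 ≤ P {ω | f ω ≠ 0} * ∫⁻ ω, f ω ^ 2 ∂P := by
  have hs : MeasurableSet {ω | f ω ≠ 0} := (hf (measurableSet_singleton 0)).compl
  -- Cauchy–Schwarz for `f` times the indicator of its support.
  have h := ENNReal.lintegral_mul_le_Lp_mul_Lq P Real.HolderConjugate.two_two hf.aemeasurable
    (measurable_one.indicator hs).aemeasurable
  have e1 : ∫⁻ ω, (f * Set.indicator {ω | f ω ≠ 0} (1 : Ω → ENNReal)) ω ∂P = ∫⁻ ω, f ω ∂P := by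
    refine lintegral_congr fun ω => ?_
    by_cases hω : f ω = 0
    · simp [hω]
    · simp [Set.indicator, hω]
  have e2 : ∫⁻ ω, Set.indicator {ω | f ω ≠ 0} (1 : Ω → ENNReal) ω ^ (2 : ℝ) ∂P =
      P {ω | f ω ≠ 0} := by
    rw [← lintegral_indicator_one hs]
    refine lintegral_congr fun ω => ?_
    by_cases hω : f ω = 0 <;> simp [Set.indicator, hω]
  rw [e1, e2] at h
  have h2 : ∀ x : ENNReal, (x ^ (1 / 2 : ℝ)) ^ 2 = x := fun x => by
    rw [← ENNReal.rpow_natCast, ← ENNReal.rpow_mul]; norm_num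
  calc (∫⁻ ω, f ω ∂P) ^ 2 ≤ _ := pow_le_pow_left₀ zero_le h 2
    _ = P {ω | f ω ≠ 0} * ∫⁻ ω, f ω ^ 2 ∂P := by
      rw [mul_pow, h2, h2, mul_comm]
      simp

/-- The kernel `u ↦ u ^ (-1/2)` on `(0, 1]`. -/
noncomputable def invSqrtKernel (u : ℝ) : ENNReal :=
  Set.indicator (Set.Ioc 0 1) (fun u => ENNReal.ofReal (1 / √u)) u

lemma measurable_invSqrtKernel : Measurable invSqrtKernel :=
  Measurable.indicator (by fun_prop) measurableSet_Ioc

lemma lintegral_invSqrtKernel_ne_top : ∫⁻ u, invSqrtKernel u ≠ ⊤ := by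
  have h := (intervalIntegral.intervalIntegrable_rpow' (a := 0) (b := 1)
    (show (-1 : ℝ) < -(1 / 2) by norm_num))
  rw [intervalIntegrable_iff_integrableOn_Ioc_of_le zero_le_one] at h
  have h2 := h.lintegral_lt_top
  unfold invSqrtKernel
  rw [lintegral_indicator measurableSet_Ioc]
  refine ne_of_lt (lt_of_le_of_lt (le_of_eq ?_) h2)
  refine setLIntegral_congr_fun measurableSet_Ioc fun u hu => ?_
  rw [Real.rpow_neg hu.1.le, ← Real.sqrt_eq_rpow, one_div]

lemma ofReal_inv_sqrt_le {τ τ' : ℝ} (hτ : τ ∈ Set.Icc (0 : ℝ) 1) (hτ' : τ' ∈ Set.Icc (0 : ℝ) 1)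
    (hne : τ ≠ τ') :
    ENNReal.ofReal (1 / √|τ - τ'|) ≤ invSqrtKernel (τ - τ') + invSqrtKernel (τ' - τ) := by
  obtain ⟨h1, h2⟩ := hτ
  obtain ⟨h3, h4⟩ := hτ'
  rcases lt_or_gt_of_ne hne with h | h
  · refine le_add_left ?_
    rw [invSqrtKernel, Set.indicator_of_mem
      (show τ' - τ ∈ Set.Ioc (0 : ℝ) 1 from ⟨by linarith, by linarith⟩),
      abs_of_neg (by linarith), neg_sub]
  · refine le_add_right ?_
    rw [invSqrtKernel, Set.indicator_of_mem
      (show τ - τ' ∈ Set.Ioc (0 : ℝ) 1 from ⟨by linarith, by linarith⟩),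
      abs_of_pos (by linarith)]

namespace DynamicalDiscreteWeb

variable {Ω : Type*} [mΩ : MeasurableSpace Ω] {P : Measure Ω} (W : DynamicalDiscreteWeb P)

/-- The dynamical times and configurations for which the events of the first `n` scales occur. -/
def scaleSet (n : ℕ) : Set (ℝ × Ω) := {p | ∀ k < n, ScaleEvent (W.arrowAt p.1 p.2) k}

lemma measurableSet_scaleSet (n : ℕ) : MeasurableSet (W.scaleSet n) := by
  have e : W.scaleSet n = ⋂ k ∈ Finset.range n,
      {p : ℝ × Ω | ScaleEvent (W.arrowAt p.1 p.2) k} := by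
    ext p; simp [scaleSet]
  rw [e]
  refine Finset.measurableSet_biInter _ fun k _ => ?_
  have hle : (inferInstance : MeasurableSpace ℝ).prod (W.siteSigma Set.univ) ≤
      (inferInstance : MeasurableSpace ℝ).prod mΩ :=
    sup_le_sup le_rfl (MeasurableSpace.comap_mono (W.siteSigma_le _))
  exact hle _ (W.measurableSet_scaleEvent k (Set.subset_univ _))

/-- The amount of dynamical time in `[0, 1]` at which the events of the first `n` scales occur. -/
noncomputable def scaleTime (n : ℕ) (ω : Ω) : ENNReal :=
  volume.restrict (Set.Icc (0 : ℝ) 1) ((fun τ => (τ, ω)) ⁻¹' W.scaleSet n)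

lemma measurable_scaleTime (n : ℕ) : Measurable (W.scaleTime n) :=
  measurable_measure_prodMk_right (W.measurableSet_scaleSet n)

lemma lintegral_scaleTime [IsProbabilityMeasure P] (n : ℕ) :
    ∫⁻ ω, W.scaleTime n ω ∂P =
      ENNReal.ofReal (∏ k ∈ Finset.range n, stayProb (4 ^ (k + 1)) (scaleDepth k)) := by
  have h := Measure.prod_apply_symm (μ := volume.restrict (Set.Icc (0 : ℝ) 1)) (ν := P)
    (W.measurableSet_scaleSet n)
  rw [Measure.prod_apply (W.measurableSet_scaleSet n)] at h
  refine h.symm.trans ?_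
  have hc : ∀ τ : ℝ, P (Prod.mk τ ⁻¹' W.scaleSet n) =
      ENNReal.ofReal (∏ k ∈ Finset.range n, stayProb (4 ^ (k + 1)) (scaleDepth k)) := by
    intro τ
    have := W.real_forall_scaleEvent τ 0 n
    simp only [zero_add] at this
    rw [← this, ofReal_measureReal]
    rfl
  simp [hc]

lemma measure_scaleSet_pair_le [IsProbabilityMeasure P] {τ τ' : ℝ}
    (hτ : τ ∈ Set.Icc (0 : ℝ) 1) (hτ' : τ' ∈ Set.Icc (0 : ℝ) 1) (hne : τ ≠ τ') (n : ℕ) :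
    P {ω | (τ, ω) ∈ W.scaleSet n ∧ (τ', ω) ∈ W.scaleSet n} ≤
      ENNReal.ofReal (2 * Real.exp 512) *
        ENNReal.ofReal (∏ k ∈ Finset.range n, stayProb (4 ^ (k + 1)) (scaleDepth k)) ^ 2 *
        (invSqrtKernel (τ - τ') + invSqrtKernel (τ' - τ)) := by
  have hΔ0 : 0 < |τ - τ'| := abs_pos.2 (sub_ne_zero.2 hne)
  have hΔ1 : |τ - τ'| ≤ 1 := by
    rw [abs_le]; constructor <;> linarith [hτ.1, hτ.2, hτ'.1, hτ'.2]
  have h := W.real_forall_scaleEvent_pair (W.isCorrelation_exp hτ.1 hτ'.1) 0 n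
  simp only [zero_add] at h
  have e : {ω | (τ, ω) ∈ W.scaleSet n ∧ (τ', ω) ∈ W.scaleSet n} =
      {ω | ∀ j < n, ScaleEvent (W.arrowAt τ ω) j ∧ ScaleEvent (W.arrowAt τ' ω) j} := by
    ext ω
    simp only [scaleSet, Set.mem_ofPred_eq]
    exact ⟨fun h j hj => ⟨h.1 j hj, h.2 j hj⟩, fun h => ⟨fun j hj => (h j hj).1,
      fun j hj => (h j hj).2⟩⟩
  have hp : 0 ≤ ∏ k ∈ Finset.range n, stayProb (4 ^ (k + 1)) (scaleDepth k) :=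
    Finset.prod_nonneg fun k _ => stayProb_nonneg _ _
  rw [e, ← ofReal_measureReal, h]
  refine (ENNReal.ofReal_le_ofReal (prod_pairStayProb_scale_le hΔ0 hΔ1 n)).trans ?_
  rw [show 2 * Real.exp 512 / √|τ - τ'| *
      (∏ k ∈ Finset.range n, stayProb (4 ^ (k + 1)) (scaleDepth k)) ^ 2 = 2 * Real.exp 512 *
      (∏ k ∈ Finset.range n, stayProb (4 ^ (k + 1)) (scaleDepth k)) ^ 2 * (1 / √|τ - τ'|) by ring,
    ENNReal.ofReal_mul (by positivity), ENNReal.ofReal_mul (by positivity), ENNReal.ofReal_pow hp]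
  gcongr
  exact ofReal_inv_sqrt_le hτ hτ' hne

/-- The square of `scaleTime` is the planar measure of pairs of good times, so Tonelli reduces it to
two-time probabilities. -/
lemma lintegral_sq_scaleTime_le [IsProbabilityMeasure P] (n : ℕ) :
    ∫⁻ ω, W.scaleTime n ω ^ 2 ∂P ≤
      ENNReal.ofReal (2 * Real.exp 512) *
        ENNReal.ofReal (∏ k ∈ Finset.range n, stayProb (4 ^ (k + 1)) (scaleDepth k)) ^ 2 *
        (2 * ∫⁻ u, invSqrtKernel u) := by
  set ν := volume.restrict (Set.Icc (0 : ℝ) 1) with hν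
  set C := ENNReal.ofReal (2 * Real.exp 512) *
    ENNReal.ofReal (∏ k ∈ Finset.range n, stayProb (4 ^ (k + 1)) (scaleDepth k)) ^ 2 with hC
  set D : Set ((ℝ × ℝ) × Ω) :=
    {q | (q.1.1, q.2) ∈ W.scaleSet n ∧ (q.1.2, q.2) ∈ W.scaleSet n} with hDdef
  have hD : MeasurableSet D := by
    refine MeasurableSet.inter (W.measurableSet_scaleSet n |>.preimage ?_)
      (W.measurableSet_scaleSet n |>.preimage ?_) <;> fun_prop
  have h := Measure.prod_apply_symm (μ := ν.prod ν) (ν := P) hD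
  rw [Measure.prod_apply hD] at h
  have e1 : ∀ ω, (ν.prod ν) ((fun x => (x, ω)) ⁻¹' D) = W.scaleTime n ω ^ 2 := by
    intro ω
    have : (fun x => (x, ω)) ⁻¹' D = ((fun τ => (τ, ω)) ⁻¹' W.scaleSet n) ×ˢ
        ((fun τ => (τ, ω)) ⁻¹' W.scaleSet n) := by
      ext x; simp [hDdef]
    rw [this, Measure.prod_prod, ← sq]
    rfl
  simp_rw [e1] at h
  rw [← h]
  have hmeas : Measurable fun x : ℝ × ℝ => P (Prod.mk x ⁻¹' D) := measurable_measure_prodMk_left hD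
  rw [lintegral_prod _ hmeas.aemeasurable]
  have hinner : ∀ τ ∈ Set.Icc (0 : ℝ) 1, ∫⁻ τ', P (Prod.mk (τ, τ') ⁻¹' D) ∂ν ≤
      C * (2 * ∫⁻ u, invSqrtKernel u) := by
    intro τ hτ
    have hae : ∀ᵐ τ' ∂ν, P (Prod.mk (τ, τ') ⁻¹' D) ≤
        C * (invSqrtKernel (τ - τ') + invSqrtKernel (τ' - τ)) := by
      have h1 : ∀ᵐ τ' ∂ν, τ' ∈ Set.Icc (0 : ℝ) 1 := ae_restrict_mem measurableSet_Icc
      -- The two-time bound is vacuous on the diagonal, which is null.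
      have h2 : ∀ᵐ τ' ∂ν, τ' ≠ τ := ae_restrict_of_ae (by simp [ae_iff])
      filter_upwards [h1, h2] with τ' h1 h2
      exact W.measure_scaleSet_pair_le hτ h1 h2.symm n
    have hk := measurable_invSqrtKernel
    refine (lintegral_mono_ae hae).trans ?_
    -- Over the whole line, translation and reflection invariance make the integral independent of
    -- `τ`.
    refine (setLIntegral_le_lintegral _ _).trans ?_
    rw [lintegral_const_mul _ (by fun_prop), lintegral_add_left (by fun_prop),
      lintegral_sub_left_eq_self, lintegral_sub_right_eq_self, two_mul]
  calc ∫⁻ τ, ∫⁻ τ', P (Prod.mk (τ, τ') ⁻¹' D) ∂ν ∂ν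
      ≤ ∫⁻ _, C * (2 * ∫⁻ u, invSqrtKernel u) ∂ν :=
        setLIntegral_mono measurable_const hinner
    _ = C * (2 * ∫⁻ u, invSqrtKernel u) := by simp [hν]

lemma scaleTime_antitone (ω : Ω) : Antitone fun n => W.scaleTime n ω := fun _ _ hmn =>
  measure_mono fun _ hτ k hk => hτ k (hk.trans_le hmn)

/-- First moment squared and second moment share the factor `p ^ 2`, positive though small; it
cancels and leaves a bound free of `n`. -/
lemma exists_pos_le_measure_scaleTime_ne_zero [IsProbabilityMeasure P] :
    ∃ c : ENNReal, 0 < c ∧ ∀ n, c ≤ P {ω | W.scaleTime n ω ≠ 0} := by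
  set B := ENNReal.ofReal (2 * Real.exp 512) * (2 * ∫⁻ u, invSqrtKernel u) with hB
  have hBtop : B ≠ ⊤ := ENNReal.mul_ne_top ENNReal.ofReal_ne_top
    (ENNReal.mul_ne_top (by simp) lintegral_invSqrtKernel_ne_top)
  refine ⟨B⁻¹, ENNReal.inv_pos.2 hBtop, fun n => ?_⟩
  set p := ENNReal.ofReal (∏ k ∈ Finset.range n, stayProb (4 ^ (k + 1)) (scaleDepth k)) with hp
  have hp0 : p ^ 2 ≠ 0 := by
    refine pow_ne_zero _ ?_
    rw [hp, ne_eq, ENNReal.ofReal_eq_zero, not_le]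
    exact Finset.prod_pos fun k _ => lt_of_lt_of_le (by norm_num) (le_stayProb_scale k)
  have hptop : p ^ 2 ≠ ⊤ := ENNReal.pow_ne_top ENNReal.ofReal_ne_top
  have h := sq_lintegral_le_measure_ne_zero_mul (P := P) (W.measurable_scaleTime n)
  rw [W.lintegral_scaleTime n, ← hp] at h
  have h2 : p ^ 2 ≤ P {ω | W.scaleTime n ω ≠ 0} * (B * p ^ 2) := by
    refine h.trans (mul_le_mul_right ((W.lintegral_sq_scaleTime_le n).trans_eq ?_) _)
    rw [← hp, hB]; ring
  rw [← mul_assoc] at h2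
  have h3 : 1 ≤ P {ω | W.scaleTime n ω ≠ 0} * B := by
    have h4 : 1 * p ^ 2 ≤ P {ω | W.scaleTime n ω ≠ 0} * B * p ^ 2 := by rwa [one_mul]
    exact (ENNReal.mul_le_mul_iff_left hp0 hptop).1 h4
  exact ENNReal.inv_le_iff_le_mul (fun h => absurd h (measure_ne_top _ _)) (fun h => absurd h hBtop)
    |>.2 (by rwa [mul_comm])

end DynamicalDiscreteWeb

/-- For all `K` large enough, with positive probability there is a dynamical time `τ ∈ [0, 1]`
at which `S_0^τ` is `K⁺`-subdiffusive. Positivity is asserted for a measurable event `A` contained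
in the (uncountable) union over `τ`, so it does not depend on measurability of that union. -/
theorem proposition3 :
    ∃ K₀ : ℝ, 0 < K₀ ∧ ∀ K : ℝ, K₀ ≤ K →
      ∀ (Ω : Type*) [MeasurableSpace Ω] (P : Measure Ω) [IsProbabilityMeasure P]
        (W : DynamicalDiscreteWeb P),
        ∃ A : Set Ω, MeasurableSet A ∧ 0 < P A ∧
          A ⊆ {ω | ∃ τ ∈ Set.Icc (0 : ℝ) 1, IsPlusSubdiffusive K (W.originPath τ ω)} := by
  refine ⟨16, by norm_num, fun K hK Ω _ P _ W => ?_⟩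
  obtain ⟨c, hc, hle⟩ := W.exists_pos_le_measure_scaleTime_ne_zero
  have hm : ∀ n, MeasurableSet {ω | W.scaleTime n ω ≠ 0} := fun n =>
    (W.measurable_scaleTime n (measurableSet_singleton 0)).compl
  have hanti : Antitone fun n => {ω | W.scaleTime n ω ≠ 0} := fun i j hij ω hω h0 =>
    hω (le_antisymm ((W.scaleTime_antitone ω hij).trans_eq h0) zero_le)
  -- The events decrease in `n`, so the uniform lower bound passes to their intersection.
  have hlim := tendsto_measure_iInter_atTop (μ := P) (fun n => (hm n).nullMeasurableSet) hanti
    ⟨0, measure_ne_top _ _⟩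
  have hpos : 0 < P (⋂ n, {ω | W.scaleTime n ω ≠ 0}) := hc.trans_le (ge_of_tendsto' hlim hle)
  have hgood : P (toMeasurable P {ω | ¬ ((∀ z, W.GoodClock z ω) ∧ W.GoodRings ω)}) = 0 := by
    rw [measure_toMeasurable]
    exact ae_iff.1 (W.ae_goodClock.and W.ae_goodRings)
  -- Removing a measurable null hull of the bad configurations keeps the event measurable without
  -- measurability of `GoodRings`.
  refine ⟨(⋂ n, {ω | W.scaleTime n ω ≠ 0}) \ toMeasurable P _,
    (MeasurableSet.iInter hm).diff (measurableSet_toMeasurable _ _),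
    by rwa [measure_sdiff_null hgood], fun ω hω => ?_⟩
  obtain ⟨hclock, hring⟩ := not_not.1 fun h => hω.2 (subset_toMeasurable P _ h)
  have hex : ∀ n, ∃ τ ∈ Set.Icc (0 : ℝ) 1, ∀ k < n, ScaleEvent (W.arrowAt τ ω) k := by
    intro n
    by_contra! hcon
    refine Set.mem_iInter.1 hω.1 n ?_
    have hn : MeasurableSet ((fun τ => (τ, ω)) ⁻¹' W.scaleSet n) :=
      measurable_prodMk_right (W.measurableSet_scaleSet n)
    rw [DynamicalDiscreteWeb.scaleTime, Measure.restrict_apply hn]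
    convert measure_empty (μ := (volume : Measure ℝ))
    refine Set.eq_empty_of_forall_notMem fun τ hτ => ?_
    obtain ⟨k, hk, hk'⟩ := hcon τ hτ.2
    exact hk' (hτ.1 k hk)
  obtain ⟨τ, hτ, h⟩ := DynamicalDiscreteWeb.exists_forall_scaleEvent hclock hring hex
  exact ⟨τ, hτ, isPlusSubdiffusive_of_scaleEvent h hK⟩
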